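/- Let $(Y,d_0)$ be a separable metric space such that every connected subset of $Y$ with more than one point has nonempty interior, let $m\ge 1$, and let $M\subset Y^m$ be a nonempty compact connected set (with respect to the metric $d(x,y)=\sum_s d_0(x_s,y_s)$). Let $P=(p_{ij})$ be a $k\times k$ transition matrix which is primitive (some power of $P$ has only positive entries), let $\bar p=(p_1,\dots,p_k)$ be its stationary probability vector, and let $\mathbb P$ be the Markov measure of $(P,\bar p)$ on $\Sigma_k=\{1,\dots,k\}^{\mathbb N}$, i.e. the law of the homogeneous Markov chain with transition matrix $P$ and initial distribution $\bar p$. Let $\sigma$ be the shift on $\Sigma_k$. Let $\mathbb P^-$ be the Markov measure of $(Q,\bar p)$, where $Q=(q_{ij})$, $q_{ij}=\frac{p_j}{p_i}p_{ji}$, is the inverse transition matrix ($\bar p$ is positive since $P$ is primitive). Let $f_1,\dots,f_k\colon M\to M$ be continuous and write $f_\omega^n=f_{\omega_{n-1}}\circ\dots\circ f_{\omega_0}$, $f^0_\omega=\mathrm{id}$. Suppose that the random product splits: there are nonempty finite words $(a_1,\dots,a_\ell)$ and $(b_1,\dots,b_r)$ with $p_{a_ia_{i+1}}>0$ and $p_{b_ib_{i+1}}>0$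 for all consecutive letters and with $a_\ell=b_r$, such that the sets $M_1=f_{a_\ell}\circ\dots\circ f_{a_1}(M)$ and $M_2=f_{b_r}\circ\dots\circ f_{b_1}(M)$ satisfy $\pi_s(f_\omega^n(M_1))\cap\pi_s(f_\omega^n(M_2))=\emptyset$ for every $\omega\in\Sigma_k$, every $n\ge 0$ and every coordinate projection $\pi_s\colon Y^m\to Y$, $s=1,\dots,m$. Call a measurable map $\rho\colon\Sigma_k\to M$ invariant if $f_{\omega_0}(\rho(\sigma\omega))=\rho(\omega)$ for $\mathbb P^-$-almost every $\omega$. Then there is an invariant map $\pi\colon\Sigma_k\to M$, and it is unique up to $\mathbb P^-$-almost everywhere equality. It is the coding map: the set $S$ of those $\omega$ for which $\bigcap_{n\ge0} f_{\omega_0}\circ\dots\circ f_{\omega_n}(M)$ is a single point has full $\mathbb P^-$-measure, and $\pi$ can be chosen such that $\pi(\omega)=\lim_{n\to\infty} f_{\omega_0}\circ\dots\circ f_{\omega_n}(x)$ for every $\omega\in S$ and every $x\in M$. Moreover, for every $x\in M$ and for $\mathbb P$-almost every $\omega\in\Sigma_k$, $$\lim_{n\to\infty}\frac1n\sum_{i=0}^{n-1}\phi(f_\omega^i(x))=\int\phi\,d(\pi_*\mathbb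 P^-)\qquad\text{for every continuous }\phi\colon M\to\mathbb R .$$ -/

import Mathlib

open MeasureTheory ProbabilityTheory Filter Topology

namespace RandomProduct

/-! ### Markov measures on the one-sided sequence space `ℕ → Fin k` -/

section Markov

variable {k : ℕ}

/-- The measure on `Fin k` whose mass at `j` is `v j`. -/
noncomputable def vecMeasure (v : Fin k → ℝ) : Measure (Fin k) :=
  ∑ j, ENNReal.ofReal (v j) • Measure.dirac j

theorem vecMeasure_singleton (v : Fin k → ℝ) (j : Fin k) :
    vecMeasure v {j} = ENNReal.ofReal (v j) := by
  classical
  simp [vecMeasure, Measure.finsetSum_apply, Set.indicator_apply]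

theorem isProbabilityMeasure_vecMeasure {v : Fin k → ℝ} (h0 : ∀ j, 0 ≤ v j)
    (h1 : ∑ j, v j = 1) : IsProbabilityMeasure (vecMeasure v) := by
  constructor
  simp [vecMeasure, Measure.finsetSum_apply, ← ENNReal.ofReal_sum_of_nonneg (fun j _ => h0 j), h1]

/-- The transition kernel on `Fin k` given by the matrix `P`. -/
noncomputable def transKernel (P : Matrix (Fin k) (Fin k) ℝ) : Kernel (Fin k) (Fin k) where
  toFun i := vecMeasure (P i)
  measurable' := measurable_of_countable _

theorem isMarkovKernel_transKernel {P : Matrix (Fin k) (Fin k) ℝ}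
    (hP : P ∈ Matrix.rowStochastic ℝ (Fin k)) : IsMarkovKernel (transKernel P) :=
  ⟨fun i => isProbabilityMeasure_vecMeasure (fun j => hP.1 i j)
    (Matrix.sum_row_of_mem_rowStochastic hP i)⟩

/-- The law of the next symbol, given the symbols at the times `0, …, n`. -/
noncomputable def stepKernel (P : Matrix (Fin k) (Fin k) ℝ) (n : ℕ) :
    Kernel ((i : Finset.Iic n) → Fin k) (Fin k) :=
  (transKernel P).comap (fun w => w ⟨n, Finset.mem_Iic.2 le_rfl⟩) (measurable_pi_apply _)

theorem isMarkovKernel_stepKernel {P : Matrix (Fin k) (Fin k) ℝ}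
    (hP : P ∈ Matrix.rowStochastic ℝ (Fin k)) (n : ℕ) : IsMarkovKernel (stepKernel P n) := by
  have := isMarkovKernel_transKernel hP
  unfold stepKernel
  infer_instance

open Classical in
/-- The Markov measure of the pair `(P, p)`: the law on `ℕ → Fin k` of the homogeneous Markov chain
with transition matrix `P` and initial distribution `p`
(by convention `0` if `P` is not a transition matrix). -/
noncomputable def markovMeasure (P : Matrix (Fin k) (Fin k) ℝ) (p : Fin k → ℝ) :
    Measure (ℕ → Fin k) :=
  if hP : P ∈ Matrix.rowStochastic ℝ (Fin k) then
    haveI := isMarkovKernel_stepKernel hP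
    Kernel.trajMeasure (X := fun _ => Fin k) (vecMeasure p) (stepKernel P)
  else 0

/-- `p` is a stationary probability vector of `P`. -/
def IsStationaryVector (P : Matrix (Fin k) (Fin k) ℝ) (p : Fin k → ℝ) : Prop :=
  (∀ i, 0 ≤ p i) ∧ ∑ i, p i = 1 ∧ Matrix.vecMul p P = p

/-- The inverse transition matrix `q i j = (p j / p i) * P j i`. -/
noncomputable def inverseMatrix (P : Matrix (Fin k) (Fin k) ℝ) (p : Fin k → ℝ) :
    Matrix (Fin k) (Fin k) ℝ :=
  Matrix.of fun i j => p j / p i * P j i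

/-- The inverse Markov measure: the Markov measure of the pair `(inverseMatrix P p, p)`. -/
noncomputable def inverseMarkovMeasure (P : Matrix (Fin k) (Fin k) ℝ) (p : Fin k → ℝ) :
    Measure (ℕ → Fin k) :=
  markovMeasure (inverseMatrix P p) p

theorem isProbabilityMeasure_markovMeasure {P : Matrix (Fin k) (Fin k) ℝ} {p : Fin k → ℝ}
    (hP : P ∈ Matrix.rowStochastic ℝ (Fin k)) (h0 : ∀ i, 0 ≤ p i) (h1 : ∑ i, p i = 1) :
    IsProbabilityMeasure (markovMeasure P p) := by
  have := isMarkovKernel_stepKernel hP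
  have := isProbabilityMeasure_vecMeasure h0 h1
  rw [markovMeasure, dif_pos hP]
  infer_instance

/-- The value of the Markov measure on cylinders. -/
theorem markovMeasure_cylinder {P : Matrix (Fin k) (Fin k) ℝ} {p : Fin k → ℝ}
    (hP : P ∈ Matrix.rowStochastic ℝ (Fin k)) (h0 : ∀ i, 0 ≤ p i) (h1 : ∑ i, p i = 1)
    (a : ℕ → Fin k) (n : ℕ) :
    markovMeasure P p {ω | ∀ i ≤ n, ω i = a i} =
      ENNReal.ofReal (p (a 0) * ∏ i ∈ Finset.range n, P (a i) (a (i + 1))) := by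
  have := isMarkovKernel_stepKernel hP
  have := isProbabilityMeasure_vecMeasure h0 h1
  have hm : markovMeasure P p =
      Kernel.trajMeasure (X := fun _ => Fin k) (vecMeasure p) (stepKernel P) := by
    rw [markovMeasure, dif_pos hP]
  rw [hm]
  set μ := Kernel.trajMeasure (X := fun _ => Fin k) (vecMeasure p) (stepKernel P) with hμ
  induction n with
  | zero =>
    have hmap : μ.map (Preorder.frestrictLe (π := fun _ => Fin k) 0) =
        (vecMeasure p).map
          (MeasurableEquiv.piUnique (fun _ : Finset.Iic (0 : ℕ) => Fin k)).symm := by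
      rw [hμ, Kernel.trajMeasure, Measure.map_comp _ _ (by fun_prop),
        Kernel.traj_map_frestrictLe, Kernel.partialTraj_self, Measure.id_comp]
    have hset : {ω : ℕ → Fin k | ∀ i ≤ 0, ω i = a i} =
        Preorder.frestrictLe (π := fun _ => Fin k) 0 ⁻¹'
          {w | w ⟨0, Finset.mem_Iic.2 le_rfl⟩ = a 0} := by
      ext ω
      simp
    rw [hset, ← Measure.map_apply (by fun_prop) (MeasurableSet.of_discrete), hmap,
      Measure.map_apply (by fun_prop) (MeasurableSet.of_discrete)]
    simp only [Finset.range_zero, Finset.prod_empty, mul_one]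
    rw [← vecMeasure_singleton]
    rfl
  | succ n ih =>
    have hstep := Kernel.map_frestrictLe_trajMeasure_compProd_eq_map_trajMeasure
      (X := fun _ => Fin k) (μ₀ := vecMeasure p) (κ := stepKernel P) (a := n)
    rw [← hμ] at hstep
    set A : Set ((i : Finset.Iic n) → Fin k) := {w | ∀ i, w i = a i} with hA
    have hset : {ω : ℕ → Fin k | ∀ i ≤ n + 1, ω i = a i} =
        (fun x => (Preorder.frestrictLe (π := fun _ => Fin k) n x, x (n + 1))) ⁻¹'
          (A ×ˢ {a (n + 1)}) := by
      ext ω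
      simp only [Set.mem_ofPred_eq, Set.mem_preimage, Set.mem_prod, Set.mem_singleton_iff, hA,
        Preorder.frestrictLe_apply, Subtype.forall, Finset.mem_Iic]
      constructor
      · exact fun h => ⟨fun i hi => h i (by omega), h _ le_rfl⟩
      · rintro ⟨h1, h2⟩ i hi
        rcases Nat.le_succ_iff.1 hi with h | h
        · exact h1 i h
        · rw [h]; exact h2
    have hset' : {ω : ℕ → Fin k | ∀ i ≤ n, ω i = a i} =
        Preorder.frestrictLe (π := fun _ => Fin k) n ⁻¹' A := by
      ext ω
      simp [hA]
    have hmA : MeasurableSet A := MeasurableSet.of_discrete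
    rw [hset, ← Measure.map_apply (by fun_prop) (hmA.prod (MeasurableSet.singleton _)), ← hstep,
      Measure.compProd_apply_prod hmA (MeasurableSet.singleton _)]
    have hc : ∀ w ∈ A, stepKernel P n w {a (n + 1)} = ENNReal.ofReal (P (a n) (a (n + 1))) := by
      intro w hw
      have hw' : w ⟨n, Finset.mem_Iic.2 le_rfl⟩ = a n := hw _
      rw [stepKernel, Kernel.comap_apply, hw']
      exact vecMeasure_singleton _ _
    rw [setLIntegral_congr_fun hmA hc, setLIntegral_const, Measure.map_apply (by fun_prop) hmA,
      ← hset', ih, ← ENNReal.ofReal_mul (hP.1 _ _), Finset.prod_range_succ]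
    congr 1
    ring

/-- A stationary vector of a primitive transition matrix is positive. -/
theorem IsStationaryVector.pos {P : Matrix (Fin k) (Fin k) ℝ} {p : Fin k → ℝ}
    (hp : IsStationaryVector P p) (hP : P.IsPrimitive) (j : Fin k) : 0 < p j := by
  obtain ⟨n, -, hn⟩ := hP.exists_pos_pow
  have key : ∀ n : ℕ, Matrix.vecMul p (P ^ n) = p := by
    intro n
    induction n with
    | zero => simp
    | succ n ih => rw [pow_succ, ← Matrix.vecMul_vecMul, ih, hp.2.2]
  have hj := congrFun (key n) j
  rw [← hj]
  obtain ⟨i, hi⟩ : ∃ i, 0 < p i := by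
    by_contra! h
    have := Finset.sum_nonpos fun i (_ : i ∈ Finset.univ) => h i
    linarith [hp.2.1]
  exact Finset.sum_pos' (fun i _ => mul_nonneg (hp.1 i) (hn i j).le)
    ⟨i, Finset.mem_univ _, mul_pos hi (hn i j)⟩

/-- The inverse transition matrix is a transition matrix. -/
theorem inverseMatrix_mem_rowStochastic {P : Matrix (Fin k) (Fin k) ℝ} {p : Fin k → ℝ}
    (hP : P ∈ Matrix.rowStochastic ℝ (Fin k)) (hp : IsStationaryVector P p)
    (hpos : ∀ i, 0 < p i) : inverseMatrix P p ∈ Matrix.rowStochastic ℝ (Fin k) := by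
  rw [Matrix.mem_rowStochastic_iff_sum]
  refine ⟨fun i j => mul_nonneg (div_nonneg (hp.1 j) (hp.1 i)) (hP.1 j i), fun i => ?_⟩
  have h : ∑ j, p j * P j i = p i := congrFun hp.2.2 i
  have h2 : ∀ j, inverseMatrix P p i j = (p j * P j i) / p i := fun j => by
    simp only [inverseMatrix, Matrix.of_apply]; ring
  simp_rw [h2]
  rw [← Finset.sum_div, h, div_self (hpos i).ne']

/-- `p` is a stationary vector of the inverse transition matrix. -/
theorem IsStationaryVector.inverseMatrix {P : Matrix (Fin k) (Fin k) ℝ} {p : Fin k → ℝ}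
    (hP : P ∈ Matrix.rowStochastic ℝ (Fin k)) (hp : IsStationaryVector P p)
    (hpos : ∀ i, 0 < p i) : IsStationaryVector (inverseMatrix P p) p := by
  refine ⟨hp.1, hp.2.1, ?_⟩
  ext j
  have h2 : ∀ i, p i * RandomProduct.inverseMatrix P p i j = p j * P j i := fun i => by
    simp only [RandomProduct.inverseMatrix, Matrix.of_apply]
    field_simp [(hpos i).ne']
  simp only [Matrix.vecMul, dotProduct, h2]
  rw [← Finset.mul_sum, Matrix.sum_row_of_mem_rowStochastic hP, mul_one]

end Markov

/-! ### Random products of maps -/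

section Maps

variable {k : ℕ} {X : Type*}

/-- The left shift on sequences. -/
def shift (ω : ℕ → Fin k) : ℕ → Fin k := fun n => ω (n + 1)

/-- The random orbit `f_ω^n = f_{ω (n-1)} ∘ ⋯ ∘ f_{ω 0}`. -/
def orbit (f : Fin k → X → X) (ω : ℕ → Fin k) : ℕ → X → X
  | 0 => id
  | n + 1 => f (ω n) ∘ orbit f ω n

/-- The iterates in reverse order `f_{ω 0} ∘ ⋯ ∘ f_{ω (n-1)}`. -/
def revOrbit (f : Fin k → X → X) (ω : ℕ → Fin k) : ℕ → X → X
  | 0 => id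
  | n + 1 => revOrbit f ω n ∘ f (ω n)

/-- For a finite word `a = [a₁, …, aₗ]`, the composition `f_{aₗ} ∘ ⋯ ∘ f_{a₁}`. -/
def wordMap (f : Fin k → X → X) (a : List (Fin k)) (x : X) : X :=
  a.foldl (fun y i => f i y) x

/-- A finite word is admissible if all its transitions have positive probability. -/
def Admissible (P : Matrix (Fin k) (Fin k) ℝ) (a : List (Fin k)) : Prop :=
  a.IsChain fun i j => 0 < P i j

/-- The splitting condition for maps `f i` of a set `M ⊆ Y ^ m`, over a Markov shift with transition
matrix `P`. -/
def Splits {Y : Type*} {m : ℕ} {M : Set (Fin m → Y)} (P : Matrix (Fin k) (Fin k) ℝ)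
    (f : Fin k → M → M) : Prop :=
  ∃ (a b : List (Fin k)) (ha : a ≠ []) (hb : b ≠ []),
    Admissible P a ∧ Admissible P b ∧ a.getLast ha = b.getLast hb ∧
    ∀ (ω : ℕ → Fin k) (n : ℕ) (s : Fin m),
      Disjoint
        ((fun y : M => (y : Fin m → Y) s) '' (orbit f ω n '' Set.range (wordMap f a)))
        ((fun y : M => (y : Fin m → Y) s) '' (orbit f ω n '' Set.range (wordMap f b)))

/-- The fibre of `ω`: the intersection of the images of `f_{ω 0} ∘ ⋯ ∘ f_{ω n}`, `n ≥ 0`. -/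
def fibre (f : Fin k → X → X) (ω : ℕ → Fin k) : Set X :=
  ⋂ n : ℕ, Set.range (revOrbit f ω (n + 1))

/-- The set of weakly hyperbolic sequences: those whose fibre is a single point. -/
def weaklyHyperbolic (f : Fin k → X → X) : Set (ℕ → Fin k) :=
  {ω | ∃ x, fibre f ω = {x}}

/-- `π` is an invariant map of the random product with respect to the measure `ν`
(to be used with the inverse Markov measure). -/
def IsInvariantMap [MeasurableSpace X] (f : Fin k → X → X) (ν : Measure (ℕ → Fin k))
    (π : (ℕ → Fin k) → X) : Prop :=
  Measurable π ∧ ∀ᵐ ω ∂ν, f (ω 0) (π (shift ω)) = π ω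

end Maps

end RandomProduct

open RandomProduct

/-!
The theorem has two halves, joined by reversal of time: the inverse chain read along a finite word
has the law of the direct chain read along the reversed word.

*Hyperbolicity.* Fix a point `y` of `Y` and a coordinate `s`. Under the inverse chain, whatever has
been read so far, there is a probability bounded below of reaching the common last letter of the two
splitting words and then of following backwards any one of them. The images of `M` under the two
continuations have disjoint projections, so one of them does not cover `y`; therefore the
probability that `y` lies in the projection of `f_{ω 0} ∘ ⋯ ∘ f_{ω n} (M)` decays geometrically
(`real_markovMeasure_le_of_splitting`). Almost surely the intersections of these projections thus
avoid a countable dense set of `Y`. Being connected, they would have interior if they were not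
points, so the fibre is a point (`mem_weaklyHyperbolic_of_forall_notMem`). The coding map is then
invariant because the inverse Markov measure is invariant under the shift, and it is unique because
an invariant map takes values in the fibres (`exists_unique_isInvariantMap`).

*Averages.* The pair `(ω n, orbit f ω n x)` is a Markov chain; let `T` be its Markov operator
(`transfer`). For continuous `φ`, reversal of time writes `p i * T^(n+1) φ (i, y)` as the
expectation of `φ (f_{ω 0} ∘ ⋯ ∘ f_{ω n} y)` on the event `ω n = i` of the inverse chain
(`integral_inverseMarkovMeasure_revOrbit`). By hyperbolicity it no longer depends on `y` in the
limit, and by primitivity of `P` further iterates no longer depend on `i`, so that `T^N φ` is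
uniformly close to the integral of `φ` against the law of the coding map
(`exists_iterate_transfer_near_integral`). The increments of the chain are orthogonal, so that `φ`
and `T^N φ` have asymptotically the same averages along almost every orbit
(`ae_tendsto_average_sub_iterate_transfer`), which gives the convergence of the averages of `φ`.
-/

namespace RandomProduct

/-! ### The Markov property in integral form -/

section Markov

variable {k : ℕ}

/-- A function of finitely many symbols is measurable, whatever the target, since it factors through
a finite discrete space. -/
theorem measurable_of_dependsOn {β : Type*} [MeasurableSpace β] {F : (ℕ → Fin k) → β} {n : ℕ}
    (hF : DependsOn F (Set.Iic n)) : Measurable F := by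
  have h : F = (fun w : Finset.Iic n → Fin k =>
      F fun i => w ⟨min i n, Finset.mem_Iic.2 (min_le_right _ _)⟩) ∘
        Preorder.frestrictLe (π := fun _ => Fin k) n := by
    ext ω
    refine hF fun i hi => ?_
    simp only [Set.mem_Iic] at hi
    simp [hi]
  rw [h]
  exact Measurable.of_discrete.comp (by fun_prop)

theorem measurableSet_of_dependsOn {A : Set (ℕ → Fin k)} {n : ℕ}
    (hA : DependsOn (fun ω => ω ∈ A) (Set.Iic n)) : MeasurableSet A :=
  measurableSet_setOfPred.2 (measurable_of_dependsOn hA)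

theorem exists_bound_of_dependsOn {F : (ℕ → Fin k) → ℝ} {n : ℕ}
    (hF : DependsOn F (Set.Iic n)) : ∃ C, ∀ ω, ‖F ω‖ ≤ C := by
  have h : Set.range F ⊆ Set.range (fun w : Finset.Iic n → Fin k =>
      F fun i => w ⟨min i n, Finset.mem_Iic.2 (min_le_right _ _)⟩) := by
    rintro _ ⟨ω, rfl⟩
    refine ⟨Preorder.frestrictLe (π := fun _ => Fin k) n ω, hF fun i hi => ?_⟩
    simp only [Set.mem_Iic] at hi
    simp [hi]
  obtain ⟨C, hC⟩ := ((Set.finite_range _).subset h).isBounded.exists_norm_le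
  exact ⟨C, fun ω => hC _ ⟨ω, rfl⟩⟩

theorem integrable_of_dependsOn {μ : Measure (ℕ → Fin k)} [IsFiniteMeasure μ]
    {F : (ℕ → Fin k) → ℝ} {n : ℕ} (hF : DependsOn F (Set.Iic n)) : Integrable F μ := by
  obtain ⟨C, hC⟩ := exists_bound_of_dependsOn hF
  exact Integrable.of_bound (measurable_of_dependsOn hF).aestronglyMeasurable C
    (Eventually.of_forall hC)

theorem integral_vecMeasure {v : Fin k → ℝ} (h0 : ∀ j, 0 ≤ v j) (g : Fin k → ℝ) :
    ∫ j, g j ∂(vecMeasure v) = ∑ j, v j * g j := by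
  rw [vecMeasure, integral_finsetSum_measure]
  · simp [integral_smul_measure, h0]
  · intro j _
    exact (integrable_dirac (by simp)).smul_measure (by simp)

variable {P : Matrix (Fin k) (Fin k) ℝ} {p : Fin k → ℝ}

/-- The Markov property, for a function of the present and past and of the next symbol. -/
theorem integral_markovMeasure_succ (hP : P ∈ Matrix.rowStochastic ℝ (Fin k))
    (h0 : ∀ i, 0 ≤ p i) (h1 : ∑ i, p i = 1) {n : ℕ} {H : (ℕ → Fin k) → Fin k → ℝ}
    (hH : ∀ j, DependsOn (fun ω => H ω j) (Set.Iic n)) :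
    ∫ ω, H ω (ω (n + 1)) ∂(markovMeasure P p) =
      ∫ ω, ∑ j, P (ω n) j * H ω j ∂(markovMeasure P p) := by
  have := isMarkovKernel_stepKernel hP
  have := isProbabilityMeasure_vecMeasure h0 h1
  have := isProbabilityMeasure_markovMeasure hP h0 h1
  set μ := markovMeasure P p with hμ'
  have hμ : μ = Kernel.trajMeasure (X := fun _ => Fin k) (vecMeasure p) (stepKernel P) := by
    rw [hμ', markovMeasure, dif_pos hP]
  have hstep := Kernel.map_frestrictLe_trajMeasure_compProd_eq_map_trajMeasure
      (X := fun _ => Fin k) (μ₀ := vecMeasure p) (κ := stepKernel P) (a := n)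
  rw [← hμ] at hstep
  set e : (Finset.Iic n → Fin k) → ℕ → Fin k :=
    fun w i => w ⟨min i n, Finset.mem_Iic.2 (min_le_right _ _)⟩ with he
  have hfact : ∀ ω j, H ω j = H (e (Preorder.frestrictLe (π := fun _ => Fin k) n ω)) j := by
    intro ω j
    refine hH j fun i hi => ?_
    simp only [Set.mem_Iic] at hi
    simp [he, hi]
  have hmeas : Measurable (fun ω : ℕ → Fin k =>
      (Preorder.frestrictLe (π := fun _ => Fin k) n ω, ω (n + 1))) := by fun_prop
  have : IsProbabilityMeasure (μ.map (Preorder.frestrictLe (π := fun _ => Fin k) n)) :=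
    Measure.isProbabilityMeasure_map (by fun_prop)
  calc ∫ ω, H ω (ω (n + 1)) ∂μ
      = ∫ z, H (e z.1) z.2 ∂(μ.map (fun ω : ℕ → Fin k =>
          (Preorder.frestrictLe (π := fun _ => Fin k) n ω, ω (n + 1)))) := by
        rw [integral_map hmeas.aemeasurable Measurable.of_discrete.aestronglyMeasurable]
        exact integral_congr_ae (Eventually.of_forall fun ω => hfact ω _)
    _ = ∫ w, ∫ j, H (e w) j ∂(stepKernel P n w)
          ∂(μ.map (Preorder.frestrictLe (π := fun _ => Fin k) n)) := by
        rw [← hstep, Measure.integral_compProd (Integrable.of_finite)]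
    _ = ∫ ω, ∑ j, P (ω n) j * H ω j ∂μ := by
        rw [integral_map (by fun_prop) Measurable.of_discrete.aestronglyMeasurable]
        refine integral_congr_ae (Eventually.of_forall fun ω => ?_)
        simp only [stepKernel, Kernel.comap_apply]
        refine (integral_vecMeasure (fun j => hP.1 _ j) _).trans ?_
        exact Finset.sum_congr rfl fun j _ => by rw [hfact ω j]; rfl

theorem integral_markovMeasure_zero (hP : P ∈ Matrix.rowStochastic ℝ (Fin k))
    (h0 : ∀ i, 0 ≤ p i) (h1 : ∑ i, p i = 1) (h : Fin k → ℝ) :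
    ∫ ω, h (ω 0) ∂(markovMeasure P p) = ∑ j, p j * h j := by
  have := isProbabilityMeasure_vecMeasure h0 h1
  have := isProbabilityMeasure_markovMeasure hP h0 h1
  have hmap : (markovMeasure P p).map (fun ω => ω 0) = vecMeasure p := by
    refine Measure.ext_of_singleton fun j => ?_
    rw [Measure.map_apply (measurable_pi_apply 0) (measurableSet_singleton j),
      vecMeasure_singleton]
    have := markovMeasure_cylinder hP h0 h1 (fun _ => j) 0
    simpa [Set.preimage] using this
  rw [← integral_vecMeasure h0, ← hmap, integral_map (measurable_pi_apply 0).aemeasurable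
    Measurable.of_discrete.aestronglyMeasurable]

/-- The Markov property over `N` steps. -/
theorem integral_mul_comp_markovMeasure (hP : P ∈ Matrix.rowStochastic ℝ (Fin k))
    (h0 : ∀ i, 0 ≤ p i) (h1 : ∑ i, p i = 1) {n : ℕ} {G : (ℕ → Fin k) → ℝ}
    (hG : DependsOn G (Set.Iic n)) (N : ℕ) (r : Fin k → ℝ) :
    ∫ ω, G ω * r (ω (n + N)) ∂(markovMeasure P p) =
      ∫ ω, G ω * ((P ^ N).mulVec r) (ω n) ∂(markovMeasure P p) := by
  induction N generalizing r with
  | zero => simp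
  | succ N ih =>
    have h := integral_markovMeasure_succ hP h0 h1 (n := n + N) (H := fun ω j => G ω * r j)
      (fun j ω ω' h => by
        simp only [hG fun i hi => h i (by simp at hi ⊢; omega)])
    rw [← add_assoc, h, pow_succ, ← Matrix.mulVec_mulVec, ← ih]
    refine integral_congr_ae (Eventually.of_forall fun ω => ?_)
    simp only [Matrix.mulVec, dotProduct, Finset.mul_sum]
    exact Finset.sum_congr rfl fun j _ => by ring

theorem real_markovMeasure_inter_next (hP : P ∈ Matrix.rowStochastic ℝ (Fin k))
    (h0 : ∀ i, 0 ≤ p i) (h1 : ∑ i, p i = 1) {n : ℕ} {A : Set (ℕ → Fin k)}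
    (hA : DependsOn (fun ω => ω ∈ A) (Set.Iic n)) (N : ℕ) (d : Fin k) :
    (markovMeasure P p).real (A ∩ {ω | ω (n + N) = d}) =
      ∫ ω, A.indicator 1 ω * (P ^ N) (ω n) d ∂(markovMeasure P p) := by
  classical
  have hG : DependsOn (A.indicator (1 : (ℕ → Fin k) → ℝ)) (Set.Iic n) := by
    intro ω ω' h
    have : ω ∈ A ↔ ω' ∈ A := iff_of_eq (hA h)
    simp [Set.indicator_apply, this]
  have h := integral_mul_comp_markovMeasure hP h0 h1 hG N (Pi.single d 1)
  have hm : MeasurableSet (A ∩ {ω | ω (n + N) = d}) :=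
    (measurableSet_of_dependsOn hA).inter
      (measurableSet_eq_fun (measurable_pi_apply (n + N)) measurable_const)
  rw [← integral_indicator_one hm]
  simp only [Matrix.mulVec_single_one, Matrix.col_apply] at h
  rw [← h]
  refine integral_congr_ae (Eventually.of_forall fun ω => ?_)
  by_cases hω : ω ∈ A <;> by_cases hd : ω (n + N) = d <;>
    simp [hω, hd]

/-- The Markov measure of a stationary vector is invariant under the shift. -/
theorem measurePreserving_shift (hP : P ∈ Matrix.rowStochastic ℝ (Fin k))
    (hp : IsStationaryVector P p) :
    MeasurePreserving (shift (k := k)) (markovMeasure P p) (markovMeasure P p) := by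
  have := isProbabilityMeasure_markovMeasure hP hp.1 hp.2.1
  have hshift : Measurable (shift (k := k)) :=
    measurable_pi_lambda _ fun n => measurable_pi_apply (n + 1)
  refine ⟨hshift, ?_⟩
  set μ := markovMeasure P p with hμ
  have hcyl : ∀ (a : ℕ → Fin k) (n : ℕ),
      μ {ω | ∀ i ≤ n, ω (i + 1) = a i} = μ {ω | ∀ i ≤ n, ω i = a i} := by
    intro a n
    let b : Fin k → ℕ → Fin k := fun j i => Nat.casesOn i j a
    have hunion : {ω : ℕ → Fin k | ∀ i ≤ n, ω (i + 1) = a i} =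
        ⋃ j, {ω | ∀ i ≤ n + 1, ω i = b j i} := by
      ext ω
      simp only [Set.mem_ofPred_eq, Set.mem_iUnion]
      constructor
      · intro h
        refine ⟨ω 0, fun i hi => ?_⟩
        cases i with
        | zero => rfl
        | succ i => exact h i (by omega)
      · rintro ⟨j, h⟩ i hi
        exact h (i + 1) (by omega)
    rw [hunion, measure_iUnion, tsum_fintype, hμ, markovMeasure_cylinder hP hp.1 hp.2.1]
    · simp_rw [markovMeasure_cylinder hP hp.1 hp.2.1]
      rw [← ENNReal.ofReal_sum_of_nonneg fun j _ => mul_nonneg (hp.1 _)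
        (Finset.prod_nonneg fun i _ => hP.1 _ _)]
      have h : ∑ j, p j * P j (a 0) = p (a 0) := congrFun hp.2.2 (a 0)
      congr 1
      rw [← h, Finset.sum_mul]
      refine Finset.sum_congr rfl fun j _ => ?_
      rw [Finset.prod_range_succ']
      change p j * ((∏ i ∈ Finset.range n, P (a i) (a (i + 1))) * P j (a 0)) = _
      ring
    · intro j j' hjj
      refine Set.disjoint_left.2 fun ω h h' => hjj ?_
      exact (h 0 (Nat.zero_le _)).symm.trans (h' 0 (Nat.zero_le _))
    · intro j
      exact measurableSet_of_dependsOn (n := n + 1) fun ω ω' h => by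
        simp only [Set.mem_ofPred_eq]
        exact propext (forall₂_congr fun i hi => by rw [h i hi])
  refine IsProjectiveLimit.unique (α := fun _ : ℕ => Fin k)
    (P := fun I => μ.map I.restrict) ?_ fun I => rfl
  refine (isProjectiveLimit_nat_iff ?_ _).2 fun n => ?_
  · intro I J hJI
    rw [Measure.map_map (by fun_prop) (by fun_prop)]
    rfl
  change (μ.map shift).map (Finset.Iic n).restrict = _
  refine Measure.ext_of_singleton fun w => ?_
  set a : ℕ → Fin k := fun i => w ⟨min i n, Finset.mem_Iic.2 (min_le_right _ _)⟩ with ha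
  have hset : (Finset.Iic n).restrict (π := fun _ => Fin k) ⁻¹' {w} =
      {ω | ∀ i ≤ n, ω i = a i} := by
    ext ω
    simp only [Set.mem_preimage, Set.mem_singleton_iff, Set.mem_ofPred_eq, funext_iff,
      Subtype.forall, Finset.mem_Iic, Finset.restrict]
    refine forall₂_congr fun i hi => ?_
    simp [ha, hi]
  have hm : Measurable ((Finset.Iic n).restrict (π := fun _ => Fin k)) := by fun_prop
  rw [Measure.map_apply hm (measurableSet_singleton w), Measure.map_apply hm
    (measurableSet_singleton w), Measure.map_apply hshift (hm (measurableSet_singleton w)), hset]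
  exact hcyl a n

end Markov

/-! ### A strong law for bounded orthogonal random variables -/

/-- Sums of a bounded real sequence are `o(n)` as soon as they are so along the squares. -/
theorem tendsto_average_of_tendsto_average_sq {d : ℕ → ℝ} {C : ℝ} (hd : ∀ i, |d i| ≤ C)
    (h : Tendsto (fun m : ℕ => (∑ i ∈ Finset.range (m ^ 2), d i) / (m : ℝ) ^ 2) atTop (𝓝 0)) :
    Tendsto (fun n : ℕ => (∑ i ∈ Finset.range n, d i) / (n : ℝ)) atTop (𝓝 0) := by
  have hC : 0 ≤ C := (abs_nonneg _).trans (hd 0)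
  have hsqrt : Tendsto Nat.sqrt atTop atTop := by
    refine tendsto_atTop.2 fun b => (eventually_ge_atTop (b * b)).mono fun n hn => ?_
    exact Nat.le_sqrt.2 hn
  have hbound : Tendsto (fun m : ℕ => |(∑ i ∈ Finset.range (m ^ 2), d i) / (m : ℝ) ^ 2| +
      2 * C * (m : ℝ)⁻¹) atTop (𝓝 0) := by
    simpa using h.abs.add (tendsto_inv_atTop_nhds_zero_nat.const_mul (2 * C))
  refine squeeze_zero_norm' ?_ (hbound.comp hsqrt)
  filter_upwards [eventually_ge_atTop 1] with n hn
  simp only [Function.comp_apply, Real.norm_eq_abs]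
  set m := Nat.sqrt n with hm
  have hm1 : 1 ≤ m := Nat.le_sqrt.2 (by omega)
  have hmn : m ^ 2 ≤ n := Nat.sqrt_le' n
  have hnm : n ≤ m ^ 2 + 2 * m := by
    have := Nat.sqrt_le_add n
    rw [← hm] at this
    nlinarith
  have hm0 : (0 : ℝ) < m := by exact_mod_cast hm1
  have hmn' : (m : ℝ) ^ 2 ≤ n := by exact_mod_cast hmn
  have hn0 : (0 : ℝ) < n := by positivity
  have hsplit : ∑ i ∈ Finset.range n, d i =
      ∑ i ∈ Finset.range (m ^ 2), d i + ∑ i ∈ Finset.Ico (m ^ 2) n, d i :=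
    (Finset.sum_range_add_sum_Ico _ hmn).symm
  have htail : |∑ i ∈ Finset.Ico (m ^ 2) n, d i| ≤ 2 * m * C := by
    calc |∑ i ∈ Finset.Ico (m ^ 2) n, d i| ≤ ∑ i ∈ Finset.Ico (m ^ 2) n, |d i| :=
          Finset.abs_sum_le_sum_abs _ _
      _ ≤ ∑ i ∈ Finset.Ico (m ^ 2) n, C := Finset.sum_le_sum fun i _ => hd i
      _ = ((n - m ^ 2 : ℕ) : ℝ) * C := by simp
      _ ≤ 2 * m * C := by
        gcongr
        have : n - m ^ 2 ≤ 2 * m := by omega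
        exact_mod_cast this
  rw [abs_div, abs_of_pos hn0, abs_div, abs_of_pos (by positivity : (0 : ℝ) < (m : ℝ) ^ 2)]
  calc |∑ i ∈ Finset.range n, d i| / n ≤ |∑ i ∈ Finset.range n, d i| / (m : ℝ) ^ 2 := by gcongr
    _ ≤ (|∑ i ∈ Finset.range (m ^ 2), d i| + 2 * m * C) / (m : ℝ) ^ 2 := by
      gcongr
      rw [hsplit]
      exact (abs_add_le _ _).trans (by gcongr)
    _ = _ := by field_simp

/-- Orthogonality bounds the second moment of the `n`-th average by a multiple of `1 / n`, which is
summable along the squares. -/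
theorem ae_tendsto_average_of_orthogonal {Ω : Type*} [MeasurableSpace Ω] {μ : Measure Ω}
    [IsProbabilityMeasure μ] {D : ℕ → Ω → ℝ} (hm : ∀ i, Measurable (D i)) {C : ℝ}
    (hC : ∀ i ω, |D i ω| ≤ C) (horth : ∀ i j, i < j → ∫ ω, D i ω * D j ω ∂μ = 0) :
    ∀ᵐ ω ∂μ, Tendsto (fun n : ℕ => (∑ i ∈ Finset.range n, D i ω) / (n : ℝ)) atTop (𝓝 0) := by
  have hint : ∀ i j, Integrable (fun ω => D i ω * D j ω) μ := fun i j =>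
    Integrable.of_bound ((hm i).mul (hm j)).aestronglyMeasurable (C * C)
      (Eventually.of_forall fun ω => by
        rw [norm_mul]
        exact mul_le_mul (hC i ω) (hC j ω) (norm_nonneg _) ((abs_nonneg _).trans (hC i ω)))
  have hsq : ∀ n : ℕ, ∫ ω, (∑ i ∈ Finset.range n, D i ω) ^ 2 ∂μ ≤ n * C ^ 2 := by
    intro n
    have h1 : ∀ ω, (∑ i ∈ Finset.range n, D i ω) ^ 2 =
        ∑ i ∈ Finset.range n, ∑ j ∈ Finset.range n, D i ω * D j ω := fun ω => by
      rw [sq, Finset.sum_mul_sum]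
    simp_rw [h1]
    rw [integral_finsetSum _ fun i _ => integrable_finsetSum _ fun j _ => hint i j]
    have h2 : ∀ i ∈ Finset.range n,
        ∫ ω, ∑ j ∈ Finset.range n, D i ω * D j ω ∂μ ≤ C ^ 2 := by
      intro i hi
      rw [integral_finsetSum _ fun j _ => hint i j, Finset.sum_eq_single_of_mem i hi]
      · calc ∫ ω, D i ω * D i ω ∂μ ≤ ∫ _, C ^ 2 ∂μ := by
              refine integral_mono (hint i i) (integrable_const _) fun ω => ?_
              have := sq_le_sq' (abs_le.1 (hC i ω)).1 (abs_le.1 (hC i ω)).2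
              simpa [sq] using this
          _ = C ^ 2 := by simp
      · intro j _ hj
        rcases lt_or_gt_of_ne hj with h | h
        · simp_rw [mul_comm (D i _)]
          exact horth j i h
        · exact horth i j h
    simpa using Finset.sum_le_sum h2
  set S : ℕ → Ω → ℝ := fun m ω => (∑ i ∈ Finset.range (m ^ 2), D i ω) / (m : ℝ) ^ 2 with hS
  have hSm : ∀ m, Measurable (S m) := fun m =>
    (Finset.measurable_sum _ fun i _ => hm i).div_const _
  have hSint : ∀ m, ∫ ω, S m ω ^ 2 ∂μ ≤ C ^ 2 * ((m : ℝ) ^ 2)⁻¹ := by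
    intro m
    rcases Nat.eq_zero_or_pos m with rfl | h0
    · simp [hS]
    have h0' : (0 : ℝ) < m := by exact_mod_cast h0
    simp only [hS, div_pow]
    rw [integral_div, div_le_iff₀ (by positivity)]
    refine (hsq _).trans (le_of_eq ?_)
    push_cast
    field_simp
  -- The second moments along the squares are summable, hence so are almost surely the squares.
  have hfin : ∫⁻ ω, ∑' m, ENNReal.ofReal (S m ω ^ 2) ∂μ ≠ ⊤ := by
    rw [lintegral_tsum fun m => ((hSm m).pow_const 2).ennreal_ofReal.aemeasurable]
    have hle : ∀ m, ∫⁻ ω, ENNReal.ofReal (S m ω ^ 2) ∂μ ≤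
        ENNReal.ofReal (C ^ 2 * ((m : ℝ) ^ 2)⁻¹) := by
      intro m
      rw [← ofReal_integral_eq_lintegral_ofReal _ (Eventually.of_forall fun ω => sq_nonneg _)]
      · exact ENNReal.ofReal_le_ofReal (hSint m)
      · refine Integrable.of_bound ((hSm m).pow_const 2).aestronglyMeasurable
          ((((m ^ 2 : ℕ) : ℝ) * C / (m : ℝ) ^ 2) ^ 2) (Eventually.of_forall fun ω => ?_)
        rw [norm_pow]
        gcongr
        simp only [hS, norm_div, norm_pow, Real.norm_eq_abs, Nat.abs_cast]
        gcongr
        refine (Finset.abs_sum_le_sum_abs _ _).trans ?_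
        have := Finset.sum_le_sum fun i (_ : i ∈ Finset.range (m ^ 2)) => hC i ω
        rwa [Finset.sum_const, Finset.card_range, nsmul_eq_mul] at this
    refine ne_top_of_le_ne_top ?_ (ENNReal.tsum_le_tsum hle)
    exact ((Real.summable_nat_pow_inv.2 one_lt_two).mul_left (C ^ 2)).tsum_ofReal_ne_top
  have hae := ae_lt_top' (AEMeasurable.tsum fun m =>
    ((hSm m).pow_const 2).ennreal_ofReal.aemeasurable) hfin
  filter_upwards [hae] with ω hω
  refine tendsto_average_of_tendsto_average_sq (fun i => hC i ω) ?_
  have h0 := ENNReal.tendsto_atTop_zero_of_tsum_ne_top hω.ne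
  have h1 : Tendsto (fun m => S m ω ^ 2) atTop (𝓝 0) := by
    have := (ENNReal.tendsto_toReal ENNReal.zero_ne_top).comp h0
    simpa [Function.comp_def, ENNReal.toReal_ofReal, sq_nonneg] using this
  have h2 := h1.sqrt
  simp only [Real.sqrt_zero, Real.sqrt_sq_eq_abs] at h2
  exact (tendsto_zero_iff_abs_tendsto_zero _).2 h2

/-! ### Iterates in reverse order and their fibres -/

/-- In a Hausdorff space, a decreasing intersection of compact connected sets is connected. -/
theorem isPreconnected_iInter_of_antitone {Y : Type*} [TopologicalSpace Y] [T2Space Y]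
    {K : ℕ → Set Y} (hanti : Antitone K) (hK : ∀ n, IsCompact (K n))
    (hconn : ∀ n, IsPreconnected (K n)) : IsPreconnected (⋂ n, K n) := by
  intro u v hu hv huv ⟨y, hyK, hyu⟩ ⟨z, hzK, hzv⟩
  by_contra hne
  have hne' : ∀ x ∈ ⋂ n, K n, x ∈ u → x ∉ v := fun x hx hxu hxv => hne ⟨x, hx, hxu, hxv⟩
  have hcpt : IsCompact (⋂ n, K n) := (hK 0).of_isClosed_subset
    (isClosed_iInter fun n => (hK n).isClosed) (Set.iInter_subset K 0)
  obtain ⟨U, V, hU, hV, hAU, hBV, hUV⟩ := SeparatedNhds.of_isCompact_isCompact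
    (hcpt.diff hv) (hcpt.diff hu) (Set.disjoint_left.2 fun x hx hx' =>
      (huv hx.1).elim hx'.2 hx.2)
  have hsub : ∀ x ∈ ⋂ n, K n, U ∪ V ∈ 𝓝 x := by
    intro x hx
    refine (hU.union hV).mem_nhds ?_
    by_cases hxv : x ∈ v
    · exact Or.inr (hBV ⟨hx, fun hxu => hne' x hx hxu hxv⟩)
    · exact Or.inl (hAU ⟨hx, hxv⟩)
  obtain ⟨n, hn⟩ := exists_subset_nhds_of_isCompact hanti.directed_ge hK hsub
  obtain ⟨x, -, hxU, hxV⟩ := hconn n U V hU hV hn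
    ⟨y, Set.mem_iInter.1 hyK n, hAU ⟨hyK, hne' y hyK hyu⟩⟩
    ⟨z, Set.mem_iInter.1 hzK n, hBV ⟨hzK, fun hzu => hne' z hzK hzu hzv⟩⟩
  exact Set.disjoint_left.1 hUV hxU hxV

section Orbits

variable {k : ℕ} {X : Type*} (f : Fin k → X → X)

theorem revOrbit_congr {ω ω' : ℕ → Fin k} {n : ℕ} (h : ∀ i < n, ω i = ω' i) :
    revOrbit f ω n = revOrbit f ω' n := by
  induction n with
  | zero => rfl
  | succ n ih =>
    simp only [revOrbit]
    rw [ih fun i hi => h i (by omega), h n (by omega)]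

theorem orbit_congr {ω ω' : ℕ → Fin k} {n : ℕ} (h : ∀ i < n, ω i = ω' i) :
    orbit f ω n = orbit f ω' n := by
  induction n with
  | zero => rfl
  | succ n ih =>
    simp only [orbit]
    rw [ih fun i hi => h i (by omega), h n (by omega)]

theorem revOrbit_succ_eq_comp_shift (ω : ℕ → Fin k) (n : ℕ) :
    revOrbit f ω (n + 1) = f (ω 0) ∘ revOrbit f (shift ω) n := by
  induction n with
  | zero => rfl
  | succ n ih =>
    rw [revOrbit, ih]
    rfl

/-- Reading a finite word backwards turns an iterate in reverse order into a random orbit. -/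
theorem exists_revOrbit_eq_orbit (ω : ℕ → Fin k) (n : ℕ) :
    ∃ ω' : ℕ → Fin k, revOrbit f ω n = orbit f ω' n := by
  induction n generalizing ω with
  | zero => exact ⟨ω, rfl⟩
  | succ n ih =>
    obtain ⟨ω', h⟩ := ih (shift ω)
    refine ⟨Function.update ω' n (ω 0), ?_⟩
    rw [revOrbit_succ_eq_comp_shift, h, orbit, Function.update_self]
    congr 1
    exact orbit_congr f fun i hi => by rw [Function.update_of_ne hi.ne]

theorem range_revOrbit_antitone (ω : ℕ → Fin k) :
    Antitone fun n => Set.range (revOrbit f ω n) :=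
  antitone_nat_of_succ_le fun _ => Set.range_comp_subset_range _ _

theorem fibre_eq_iInter (ω : ℕ → Fin k) : fibre f ω = ⋂ n, Set.range (revOrbit f ω n) :=
  (range_revOrbit_antitone f ω).iInter_nat_add 1

variable {f} [TopologicalSpace X]

theorem continuous_revOrbit (hf : ∀ i, Continuous (f i)) (ω : ℕ → Fin k) (n : ℕ) :
    Continuous (revOrbit f ω n) := by
  induction n with
  | zero => exact continuous_id
  | succ n ih => exact ih.comp (hf _)

variable [CompactSpace X] [T2Space X]

/-- At a weakly hyperbolic sequence the iterates in reverse order converge to the point of the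
fibre, whatever the points they are applied to. -/
theorem tendsto_revOrbit (hf : ∀ i, Continuous (f i)) {ω : ℕ → Fin k} {z : X}
    (hz : fibre f ω = {z}) (y : ℕ → X) :
    Tendsto (fun n => revOrbit f ω (n + 1) (y n)) atTop (𝓝 z) := by
  intro U hU
  obtain ⟨n, hn⟩ := exists_subset_nhds_of_isCompact
    (V := fun n => Set.range (revOrbit f ω n)) (range_revOrbit_antitone f ω).directed_ge
    (fun n => isCompact_range (continuous_revOrbit hf ω n)) (U := U) (fun x hx => by
      rw [← fibre_eq_iInter, hz] at hx
      rwa [Set.mem_singleton_iff.1 hx])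
  refine mem_map.2 ((eventually_ge_atTop n).mono fun i hi => ?_)
  exact hn (range_revOrbit_antitone f ω (hi.trans (Nat.le_succ i)) ⟨y i, rfl⟩)

/-- Suppose that a family of continuous maps `c s` separates the points of a connected space `X`
and that the nontrivial connected sets of the target have interior. Then a fibre is a point as soon
as its images under the maps `c s` avoid a dense set: these images are contained in connected
sets, which cannot be nontrivial without meeting the dense set. -/
theorem mem_weaklyHyperbolic_of_forall_notMem [ConnectedSpace X] {Y : Type*} [TopologicalSpace Y]
    [T2Space Y] (hY : ∀ C : Set Y, IsConnected C → C.Nontrivial → (interior C).Nonempty)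
    {D : Set Y} (hD : Dense D) {ι : Type*} {c : ι → X → Y} (hc : ∀ s, Continuous (c s))
    (hsep : ∀ x x', (∀ s, c s x = c s x') → x = x') (hf : ∀ i, Continuous (f i))
    {ω : ℕ → Fin k}
    (h : ∀ s, ∀ y ∈ D, y ∉ ⋂ n, c s '' Set.range (revOrbit f ω n)) :
    ω ∈ weaklyHyperbolic f := by
  have hcpt : ∀ n, IsCompact (Set.range (revOrbit f ω n)) := fun n =>
    isCompact_range (continuous_revOrbit hf ω n)
  obtain ⟨z, hz⟩ : (fibre f ω).Nonempty := by
    rw [fibre_eq_iInter]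
    exact IsCompact.nonempty_iInter_of_directed_nonempty_isCompact_isClosed _
      (range_revOrbit_antitone f ω).directed_ge (fun n => Set.range_nonempty _) hcpt
      fun n => (hcpt n).isClosed
  have hsub : ∀ s, ∀ x ∈ fibre f ω, c s x ∈ ⋂ n, c s '' Set.range (revOrbit f ω n) := by
    intro s x hx
    rw [fibre_eq_iInter] at hx
    exact Set.mem_iInter.2 fun n => ⟨x, Set.mem_iInter.1 hx n, rfl⟩
  refine ⟨z, Set.eq_singleton_iff_unique_mem.2 ⟨hz, fun x hx => hsep x z fun s => ?_⟩⟩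
  by_contra hne
  have hconn : IsPreconnected (⋂ n, c s '' Set.range (revOrbit f ω n)) :=
    isPreconnected_iInter_of_antitone
      (fun i j hij => Set.image_mono (range_revOrbit_antitone f ω hij))
      (fun n => (hcpt n).image (hc s)) fun n =>
      ((isPreconnected_range (continuous_revOrbit hf ω n)).image _ (hc s).continuousOn)
  obtain ⟨y, hy, hyD⟩ := hD.exists_mem_open isOpen_interior
    (hY _ ⟨⟨_, hsub s z hz⟩, hconn⟩ ⟨_, hsub s x hx, _, hsub s z hz, hne⟩)
  exact h s y hy (interior_subset hyD)

end Orbits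

/-! ### Almost every sequence is weakly hyperbolic -/

/-- Reversal of time commutes with powers: a power of the inverse transition matrix is the inverse
transition matrix of the power. -/
theorem inverseMatrix_pow_apply {k : ℕ} {P : Matrix (Fin k) (Fin k) ℝ} {p : Fin k → ℝ}
    (hpos : ∀ i, 0 < p i) (n : ℕ) (i j : Fin k) :
    (inverseMatrix P p ^ n) i j = p j / p i * (P ^ n) j i := by
  induction n generalizing j with
  | zero =>
    by_cases h : i = j
    · simp [h, (hpos j).ne']
    · simp [h, Ne.symm h]
  | succ n ih =>
    rw [pow_succ, pow_succ', Matrix.mul_apply, Matrix.mul_apply, Finset.mul_sum]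
    refine Finset.sum_congr rfl fun l _ => ?_
    rw [ih, inverseMatrix, Matrix.of_apply]
    field_simp [(hpos l).ne', (hpos i).ne']

section Hyperbolicity

variable {k : ℕ} {X Y : Type*} {P Q : Matrix (Fin k) (Fin k) ℝ} {p : Fin k → ℝ}

/-- A chain with transition matrix `Q` that sits at the last letter of a word admissible for the
reversed transitions follows the word backwards with a probability bounded below. -/
theorem exists_follow_word_backwards (hQ : Q ∈ Matrix.rowStochastic ℝ (Fin k))
    (h0 : ∀ i, 0 ≤ p i) (h1 : ∑ i, p i = 1) (hPQ : ∀ i j, 0 < P i j → 0 < Q j i)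
    (f : Fin k → X → X) (l : List (Fin k)) (c : Fin k) (hl : Admissible P (l ++ [c])) :
    ∃ δ : ℝ, 0 < δ ∧ ∃ L : ℕ, ∀ (n : ℕ) (A : Set (ℕ → Fin k)),
      DependsOn (fun ω => ω ∈ A) (Set.Iic n) → (∀ ω ∈ A, ω n = c) →
      ∃ B ⊆ A, MeasurableSet B ∧
        δ * (markovMeasure Q p).real A ≤ (markovMeasure Q p).real B ∧
        ∀ ω ∈ B, Set.range (revOrbit f ω (n + L)) ⊆
          revOrbit f ω n '' Set.range (wordMap f (l ++ [c])) := by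
  have := isProbabilityMeasure_markovMeasure hQ h0 h1
  induction l using List.reverseRecOn generalizing c with
  | nil =>
    refine ⟨1, one_pos, 1, fun n A hA hAc => ⟨A, subset_rfl, measurableSet_of_dependsOn hA,
      by simp, fun ω hω => ?_⟩⟩
    rw [revOrbit, hAc ω hω, Set.range_comp]
    rfl
  | append_singleton l d ih =>
    have hl' : Admissible P (l ++ [d]) ∧ 0 < P d c := by
      rw [Admissible, List.isChain_append] at hl
      exact ⟨hl.1, hl.2.2 d (by simp) c (by simp)⟩
    obtain ⟨δ, hδ, L, h⟩ := ih d hl'.1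
    have hpos : 0 < Q c d := hPQ _ _ hl'.2
    refine ⟨δ * Q c d, mul_pos hδ hpos, L + 1, fun n A hA hAc => ?_⟩
    have hA' : DependsOn (fun ω => ω ∈ A ∩ {ω | ω (n + 1) = d}) (Set.Iic (n + 1)) := by
      intro ω ω' hω
      have h2 : (ω ∈ A) = (ω' ∈ A) := hA fun i hi => hω i (by simp at hi ⊢; omega)
      have h3 : ω (n + 1) = ω' (n + 1) := hω _ (by simp)
      simp [h2, h3]
    obtain ⟨B, hBA, hBm, hB, hBr⟩ := h (n + 1) _ hA' fun ω hω => hω.2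
    refine ⟨B, hBA.trans Set.inter_subset_left, hBm, ?_, fun ω hω => ?_⟩
    · refine le_trans (le_of_eq ?_) hB
      rw [real_markovMeasure_inter_next hQ h0 h1 hA, pow_one,
        ← integral_indicator_one (measurableSet_of_dependsOn hA), mul_assoc,
        ← integral_const_mul]
      congr 1
      refine integral_congr_ae (Eventually.of_forall fun ω => ?_)
      by_cases hω : ω ∈ A
      · simp [hω, hAc ω hω]
      · simp [hω]
    · have hr := hBr ω hω
      rw [show n + 1 + L = n + (L + 1) by ring] at hr
      refine hr.trans (le_of_eq ?_)
      have hc : ω n = c := hAc ω (hBA hω).1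
      have hw : wordMap f (l ++ [d] ++ [c]) = f c ∘ wordMap f (l ++ [d]) := by
        ext x
        simp [wordMap]
      rw [hw, Set.range_comp (f c), revOrbit, hc, Set.image_comp]

/-- From any state the chain reaches the common last letter of the two words with a probability
bounded below, and then follows backwards either of them; as the two resulting images are disjoint,
one of the two continuations discards `y`. Hence the probability that `y` is still covered decays
geometrically. -/
theorem real_markovMeasure_le_of_splitting (hQ : Q ∈ Matrix.rowStochastic ℝ (Fin k))
    (h0 : ∀ i, 0 ≤ p i) (h1 : ∑ i, p i = 1) (hPQ : ∀ i j, 0 < P i j → 0 < Q j i)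
    {N : ℕ} (hN : ∀ i j, 0 < (Q ^ N) i j) (f : Fin k → X → X) (g : X → Y)
    {a b : List (Fin k)} {e : Fin k} (ha : Admissible P (a ++ [e])) (hb : Admissible P (b ++ [e]))
    (hdisj : ∀ (ω : ℕ → Fin k) (n : ℕ),
      Disjoint (g '' (revOrbit f ω n '' Set.range (wordMap f (a ++ [e]))))
        (g '' (revOrbit f ω n '' Set.range (wordMap f (b ++ [e]))))) (y : Y) :
    ∃ δ : ℝ, 0 < δ ∧ ∃ L : ℕ, ∀ n : ℕ,
      (markovMeasure Q p).real {ω | y ∈ g '' Set.range (revOrbit f ω (n + L))} ≤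
        (1 - δ) * (markovMeasure Q p).real {ω | y ∈ g '' Set.range (revOrbit f ω n)} := by
  have := isProbabilityMeasure_markovMeasure hQ h0 h1
  set μ := markovMeasure Q p with hμ
  obtain ⟨δ₁, hδ₁, L₁, H₁⟩ := exists_follow_word_backwards hQ h0 h1 hPQ f a e ha
  obtain ⟨δ₂, hδ₂, L₂, H₂⟩ := exists_follow_word_backwards hQ h0 h1 hPQ f b e hb
  have : Nonempty (Fin k) := ⟨e⟩
  obtain ⟨i₀, hi₀⟩ := Finite.exists_min fun i => (Q ^ N) i e
  set E : ℕ → Set (ℕ → Fin k) := fun n => {ω | y ∈ g '' Set.range (revOrbit f ω n)} with hE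
  have hEanti : Antitone E := fun i j hij ω hω =>
    Set.image_mono (range_revOrbit_antitone f ω hij) hω
  have hdep : ∀ {n m : ℕ}, n ≤ m + 1 → ∀ {ω ω' : ℕ → Fin k}, (∀ i ∈ Set.Iic m, ω i = ω' i) →
      revOrbit f ω n = revOrbit f ω' n := fun hnm _ _ h =>
    revOrbit_congr f fun i hi => h i (by simp; omega)
  have hEdep : ∀ {n m : ℕ}, n ≤ m + 1 → DependsOn (fun ω => ω ∈ E n) (Set.Iic m) :=
    fun hnm ω ω' h => by
      simp only [hE, Set.mem_ofPred_eq]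
      rw [hdep hnm h]
  refine ⟨min δ₁ δ₂ * (Q ^ N) i₀ e, mul_pos (lt_min hδ₁ hδ₂) (hN _ _), N + max L₁ L₂,
    fun n => ?_⟩
  set A : Set (ℕ → Fin k) := E n ∩ {ω | ω (n + N) = e} with hA
  have hAdep : ∀ {ω ω' : ℕ → Fin k}, (∀ i ∈ Set.Iic (n + N), ω i = ω' i) →
      (ω ∈ A ↔ ω' ∈ A) := by
    intro ω ω' h
    have h2 : (ω ∈ E n) = (ω' ∈ E n) := hEdep (by omega) h
    have h3 : ω (n + N) = ω' (n + N) := h _ (by simp)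
    simp [hA, h2, h3]
  have hAmeas : (Q ^ N) i₀ e * μ.real (E n) ≤ μ.real A := by
    rw [hA, hμ, real_markovMeasure_inter_next hQ h0 h1 (hEdep (Nat.le_succ n)),
      ← integral_indicator_one (measurableSet_of_dependsOn (hEdep (Nat.le_succ n))),
      ← integral_const_mul]
    have hind : DependsOn ((E n).indicator (1 : (ℕ → Fin k) → ℝ)) (Set.Iic n) := by
      classical
      intro ω ω' h
      have h2 : (ω ∈ E n) = (ω' ∈ E n) := hEdep (by omega) h
      simp [Set.indicator_apply, h2]
    refine integral_mono ((integrable_of_dependsOn hind).const_mul _)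
      (integrable_of_dependsOn (n := n) fun ω ω' h => ?_) fun ω => ?_
    · simp only [hind h, h n (by simp)]
    · dsimp only
      rw [mul_comm]
      exact mul_le_mul_of_nonneg_left (hi₀ _) (Set.indicator_nonneg (by simp) _)
  -- The part of `A` from which following `a` backwards discards `y`; from its complement,
  -- following `b` backwards does.
  set T : Set (ℕ → Fin k) :=
    {ω | y ∉ g '' (revOrbit f ω (n + N) '' Set.range (wordMap f (a ++ [e])))} with hT
  have hTdep : ∀ {ω ω' : ℕ → Fin k}, (∀ i ∈ Set.Iic (n + N), ω i = ω' i) →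
      (ω ∈ T ↔ ω' ∈ T) := by
    intro ω ω' h
    simp only [hT, Set.mem_ofPred_eq]
    rw [hdep (Nat.le_succ _) h]
  obtain ⟨B₁, hBA₁, hBm₁, hB₁, hBr₁⟩ := H₁ (n + N) (A ∩ T)
    (fun ω ω' h => by simp only [Set.mem_inter_iff, hAdep h, hTdep h]) fun ω hω => hω.1.2
  obtain ⟨B₂, hBA₂, hBm₂, hB₂, hBr₂⟩ := H₂ (n + N) (A \ T)
    (fun ω ω' h => by simp only [Set.mem_sdiff, hAdep h, hTdep h]) fun ω hω => hω.1.2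
  have hBB : Disjoint B₁ B₂ :=
    Set.disjoint_left.2 fun ω h h' => (hBA₂ h').2 (hBA₁ h).2
  have hAT : MeasurableSet T := measurableSet_of_dependsOn (n := n + N)
    fun ω ω' h => propext (hTdep h)
  have hsub : E (n + (N + max L₁ L₂)) ⊆ E n \ (B₁ ∪ B₂) := by
    intro ω hω
    refine ⟨hEanti (Nat.le_add_right _ _) hω, ?_⟩
    rintro (h | h)
    · have hω' : ω ∈ E (n + N + L₁) := hEanti (by have := le_max_left L₁ L₂; omega) hω
      exact (hBA₁ h).2 (Set.image_mono (hBr₁ ω h) hω')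
    · have hω' : ω ∈ E (n + N + L₂) := hEanti (by have := le_max_right L₁ L₂; omega) hω
      have hnT : y ∈ g '' (revOrbit f ω (n + N) '' Set.range (wordMap f (a ++ [e]))) :=
        not_not.1 (hBA₂ h).2
      exact Set.disjoint_left.1 (hdisj ω (n + N)) hnT (Set.image_mono (hBr₂ ω h) hω')
  have hBE : B₁ ∪ B₂ ⊆ E n := Set.union_subset (fun ω h => (hBA₁ h).1.1) fun ω h => (hBA₂ h).1.1
  have hfin : μ.real (E (n + (N + max L₁ L₂))) ≤ μ.real (E n) - (μ.real B₁ + μ.real B₂) := by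
    rw [← measureReal_union hBB hBm₂, ← measureReal_sdiff hBE (hBm₁.union hBm₂)]
    exact measureReal_mono hsub
  have hsplit : μ.real (A ∩ T) + μ.real (A \ T) = μ.real A := measureReal_inter_add_sdiff hAT
  have hd₁ : min δ₁ δ₂ * μ.real (A ∩ T) ≤ μ.real B₁ :=
    (mul_le_mul_of_nonneg_right (min_le_left _ _) measureReal_nonneg).trans hB₁
  have hd₂ : min δ₁ δ₂ * μ.real (A \ T) ≤ μ.real B₂ :=
    (mul_le_mul_of_nonneg_right (min_le_right _ _) measureReal_nonneg).trans hB₂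
  have hd : min δ₁ δ₂ * ((Q ^ N) i₀ e * μ.real (E n)) ≤ min δ₁ δ₂ * μ.real A :=
    mul_le_mul_of_nonneg_left hAmeas (lt_min hδ₁ hδ₂).le
  rw [← hsplit, mul_add] at hd
  change μ.real (E _) ≤ _ * μ.real (E n)
  linarith

/-- Almost surely, a given point `y` is eventually not covered by the images under `g` of the ranges
of the iterates in reverse order. -/
theorem markovMeasure_setOf_mem_iInter_eq_zero (hQ : Q ∈ Matrix.rowStochastic ℝ (Fin k))
    (h0 : ∀ i, 0 ≤ p i) (h1 : ∑ i, p i = 1) (hPQ : ∀ i j, 0 < P i j → 0 < Q j i)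
    {N : ℕ} (hN : ∀ i j, 0 < (Q ^ N) i j) (f : Fin k → X → X) (g : X → Y)
    {a b : List (Fin k)} {e : Fin k} (ha : Admissible P (a ++ [e])) (hb : Admissible P (b ++ [e]))
    (hdisj : ∀ (ω : ℕ → Fin k) (n : ℕ),
      Disjoint (g '' (revOrbit f ω n '' Set.range (wordMap f (a ++ [e]))))
        (g '' (revOrbit f ω n '' Set.range (wordMap f (b ++ [e]))))) (y : Y) :
    markovMeasure Q p {ω | y ∈ ⋂ n, g '' Set.range (revOrbit f ω n)} = 0 := by
  have := isProbabilityMeasure_markovMeasure hQ h0 h1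
  obtain ⟨δ, hδ, L, h⟩ := real_markovMeasure_le_of_splitting hQ h0 h1 hPQ hN f g ha hb hdisj y
  set q : ℕ → ℝ := fun n =>
    (markovMeasure Q p).real {ω | y ∈ g '' Set.range (revOrbit f ω n)} with hq
  have hanti : Antitone q := fun i j hij =>
    measureReal_mono fun ω hω => Set.image_mono (range_revOrbit_antitone f ω hij) hω
  have hlim : Tendsto q atTop (𝓝 (⨅ n, q n)) :=
    tendsto_atTop_ciInf hanti ⟨0, by rintro _ ⟨n, rfl⟩; exact measureReal_nonneg⟩
  -- The limit `r` of the probabilities satisfies `r ≤ (1 - δ) * r`.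
  have hle : ⨅ n, q n ≤ (1 - δ) * ⨅ n, q n :=
    le_of_tendsto_of_tendsto' (hlim.comp (tendsto_add_atTop_nat L)) (hlim.const_mul _) h
  have hzero : ⨅ n, q n ≤ 0 := by nlinarith
  rw [← measureReal_eq_zero_iff]
  refine le_antisymm (le_trans (le_ciInf fun n => ?_) hzero) measureReal_nonneg
  exact measureReal_mono fun ω hω => Set.mem_iInter.1 hω n

end Hyperbolicity

/-! ### Convergence of the powers of a primitive transition matrix -/

section Doeblin

variable {k : ℕ} {P : Matrix (Fin k) (Fin k) ℝ} {p : Fin k → ℝ}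

/-- A transition matrix with entries at least `δ` contracts the oscillation of vectors
by the factor `1 - δ`. -/
theorem mulVec_sub_mulVec_le {A : Matrix (Fin k) (Fin k) ℝ}
    (hA : A ∈ Matrix.rowStochastic ℝ (Fin k)) {δ : ℝ} (hδ : ∀ i j, δ ≤ A i j) {h : Fin k → ℝ}
    {r : ℝ} (hr : ∀ i i', h i - h i' ≤ r) (i i' : Fin k) :
    A.mulVec h i - A.mulVec h i' ≤ (1 - δ) * r := by
  have : Nonempty (Fin k) := ⟨i⟩
  obtain ⟨j₀, hj₀⟩ := Finite.exists_min h
  have hr0 : 0 ≤ r := by simpa using hr i i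
  have hdiff : ∀ l, A.mulVec h l - h j₀ = ∑ j, A l j * (h j - h j₀) := by
    intro l
    simp only [mul_sub, Finset.sum_sub_distrib, ← Finset.sum_mul,
      Matrix.sum_row_of_mem_rowStochastic hA, one_mul]
    rfl
  have hlow : 0 ≤ A.mulVec h i' - h j₀ := by
    rw [hdiff]
    exact Finset.sum_nonneg fun j _ => mul_nonneg (hA.1 _ _) (sub_nonneg.2 (hj₀ j))
  have hupp : A.mulVec h i - h j₀ ≤ (1 - δ) * r := by
    rw [hdiff]
    calc ∑ j, A i j * (h j - h j₀) ≤ ∑ j, (A i j * r - if j = j₀ then δ * r else 0) := by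
          refine Finset.sum_le_sum fun j _ => ?_
          split_ifs with hj
          · rw [hj, sub_self, mul_zero, ← sub_mul]
            exact mul_nonneg (sub_nonneg.2 (hδ _ _)) hr0
          · rw [sub_zero]
            exact mul_le_mul_of_nonneg_left (hr _ _) (hA.1 _ _)
      _ = (1 - δ) * r := by
          rw [Finset.sum_sub_distrib, ← Finset.sum_mul, Matrix.sum_row_of_mem_rowStochastic hA]
          simp [sub_mul]
  linarith

theorem vecMul_pow_of_isStationaryVector (hp : IsStationaryVector P p) (n : ℕ) :
    Matrix.vecMul p (P ^ n) = p := by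
  induction n with
  | zero => simp
  | succ n ih => rw [pow_succ, ← Matrix.vecMul_vecMul, ih, hp.2.2]

/-- The powers of a primitive transition matrix converge to the projection onto the constants along
the stationary vector, because some power has positive entries and hence contracts oscillations. -/
theorem exists_pow_mulVec_near (hP : P ∈ Matrix.rowStochastic ℝ (Fin k))
    (hp : IsStationaryVector P p) (hprim : P.IsPrimitive) (g : Fin k → ℝ) {ε : ℝ} (hε : 0 < ε) :
    ∃ m : ℕ, ∀ i, |(P ^ m).mulVec g i - p ⬝ᵥ g| ≤ ε := by
  rcases isEmpty_or_nonempty (Fin k) with hk | hk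
  · exact ⟨0, fun i => hk.elim i⟩
  obtain ⟨N, -, hN⟩ := hprim.exists_pos_pow
  have hPN : ∀ n, P ^ n ∈ Matrix.rowStochastic ℝ (Fin k) := fun n => pow_mem hP n
  obtain ⟨⟨i₀, j₀⟩, hmin⟩ := Finite.exists_min fun x : Fin k × Fin k => (P ^ N) x.1 x.2
  set δ := (P ^ N) i₀ j₀
  have hδ : 0 < δ := hN _ _
  have hδ1 : δ ≤ 1 := by
    rw [← Matrix.sum_row_of_mem_rowStochastic (hPN N) i₀]
    exact Finset.single_le_sum (f := fun j => (P ^ N) i₀ j) (fun j _ => (hPN N).1 _ _)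
      (Finset.mem_univ j₀)
  obtain ⟨a, ha⟩ := Finite.exists_max g
  obtain ⟨b, hb⟩ := Finite.exists_min g
  have hosc : ∀ t : ℕ, ∀ i i',
      (P ^ (N * t)).mulVec g i - (P ^ (N * t)).mulVec g i' ≤ (1 - δ) ^ t * (g a - g b) := by
    intro t
    induction t with
    | zero =>
      intro i i'
      simpa using sub_le_sub (ha i) (hb i')
    | succ t ih =>
      intro i i'
      rw [Nat.mul_succ, add_comm, pow_add, ← Matrix.mulVec_mulVec, pow_succ', mul_assoc]
      exact mulVec_sub_mulVec_le (hPN N) (fun i j => hmin (i, j)) ih i i'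
  have hlim : Tendsto (fun t : ℕ => (1 - δ) ^ t * (g a - g b)) atTop (𝓝 0) := by
    simpa using (tendsto_pow_atTop_nhds_zero_of_lt_one (sub_nonneg.2 hδ1)
      (sub_lt_self 1 hδ)).mul_const (g a - g b)
  obtain ⟨t, ht⟩ := (hlim.eventually_le_const hε).exists
  refine ⟨N * t, fun i => ?_⟩
  have hmean : (P ^ (N * t)).mulVec g i - p ⬝ᵥ g =
      ∑ j, p j * ((P ^ (N * t)).mulVec g i - (P ^ (N * t)).mulVec g j) := by
    simp only [mul_sub, Finset.sum_sub_distrib, ← Finset.sum_mul, hp.2.1, one_mul]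
    congr 1
    nth_rw 1 [← vecMul_pow_of_isStationaryVector hp (N * t)]
    rw [← Matrix.dotProduct_mulVec]
    rfl
  rw [hmean]
  calc |∑ j, p j * ((P ^ (N * t)).mulVec g i - (P ^ (N * t)).mulVec g j)|
      ≤ ∑ j, |p j * ((P ^ (N * t)).mulVec g i - (P ^ (N * t)).mulVec g j)| :=
        Finset.abs_sum_le_sum_abs _ _
    _ ≤ ∑ j, p j * ε := by
        refine Finset.sum_le_sum fun j _ => ?_
        rw [abs_mul, abs_of_nonneg (hp.1 j)]
        refine mul_le_mul_of_nonneg_left (abs_le.2 ⟨?_, ?_⟩) (hp.1 j)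
        · linarith [hosc t j i]
        · linarith [hosc t i j]
    _ = ε := by rw [← Finset.sum_mul, hp.2.1, one_mul]

end Doeblin

/-! ### The transfer operator and averages along random orbits -/

section Transfer

variable {k : ℕ} {X : Type*} {P : Matrix (Fin k) (Fin k) ℝ} {p : Fin k → ℝ}

/-- The Markov operator, acting on functions `h i y`, of the chain `(ω n, orbit f ω n x)`: from the
state `(i, y)` the chain moves to `(j, f i y)` with probability `P i j`. -/
def transfer (P : Matrix (Fin k) (Fin k) ℝ) (f : Fin k → X → X) (h : Fin k → X → ℝ) :
    Fin k → X → ℝ :=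
  fun i y => ∑ j, P i j * h j (f i y)

variable (f : Fin k → X → X)

theorem abs_transfer_sub_le (hP : P ∈ Matrix.rowStochastic ℝ (Fin k)) {h h' : Fin k → X → ℝ}
    {ε : ℝ} (hε : ∀ i y, |h i y - h' i y| ≤ ε) (i : Fin k) (y : X) :
    |transfer P f h i y - transfer P f h' i y| ≤ ε := by
  simp only [transfer]
  rw [← Finset.sum_sub_distrib]
  calc |∑ j, (P i j * h j (f i y) - P i j * h' j (f i y))|
      ≤ ∑ j, |P i j * h j (f i y) - P i j * h' j (f i y)| := Finset.abs_sum_le_sum_abs _ _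
    _ ≤ ∑ j, P i j * ε := by
        refine Finset.sum_le_sum fun j _ => ?_
        rw [← mul_sub, abs_mul, abs_of_nonneg (hP.1 i j)]
        exact mul_le_mul_of_nonneg_left (hε _ _) (hP.1 i j)
    _ = ε := by rw [← Finset.sum_mul, Matrix.sum_row_of_mem_rowStochastic hP, one_mul]

theorem abs_iterate_transfer_sub_le (hP : P ∈ Matrix.rowStochastic ℝ (Fin k))
    {h h' : Fin k → X → ℝ} {ε : ℝ} (hε : ∀ i y, |h i y - h' i y| ≤ ε) (n : ℕ) (i : Fin k)
    (y : X) : |(transfer P f)^[n] h i y - (transfer P f)^[n] h' i y| ≤ ε := by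
  induction n generalizing i y with
  | zero => exact hε i y
  | succ n ih =>
    rw [Function.iterate_succ_apply', Function.iterate_succ_apply']
    exact abs_transfer_sub_le f hP ih i y

theorem abs_transfer_le (hP : P ∈ Matrix.rowStochastic ℝ (Fin k)) {h : Fin k → X → ℝ} {C : ℝ}
    (hC : ∀ i y, |h i y| ≤ C) (i : Fin k) (y : X) : |transfer P f h i y| ≤ C := by
  have h0 : transfer P f (fun _ _ => 0) i y = 0 := by simp [transfer]
  simpa [h0] using abs_transfer_sub_le f hP (h := h) (h' := fun _ _ => 0) (by simpa using hC) i y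

theorem iterate_transfer_const_right (g : Fin k → ℝ) (n : ℕ) :
    (transfer P f)^[n] (fun i _ => g i) = fun i _ => (P ^ n).mulVec g i := by
  induction n with
  | zero => simp
  | succ n ih =>
    rw [Function.iterate_succ_apply', ih, pow_succ']
    ext i y
    rw [← Matrix.mulVec_mulVec]
    rfl

/-- The increments `h (Z (n + 1)) - (transfer P f h) (Z n)`, where `Z n = (ω n, orbit f ω n x)`,
are bounded and orthogonal, so that they average to zero. -/
theorem ae_tendsto_average_increments (hP : P ∈ Matrix.rowStochastic ℝ (Fin k))
    (h0 : ∀ i, 0 ≤ p i) (h1 : ∑ i, p i = 1) {h : Fin k → X → ℝ} {C : ℝ}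
    (hC : ∀ i y, |h i y| ≤ C) (x : X) :
    ∀ᵐ ω ∂(markovMeasure P p), Tendsto (fun n : ℕ => (∑ i ∈ Finset.range n,
      (h (ω (i + 1)) (orbit f ω (i + 1) x) - transfer P f h (ω i) (orbit f ω i x))) / (n : ℝ))
      atTop (𝓝 0) := by
  have := isProbabilityMeasure_markovMeasure hP h0 h1
  set D : ℕ → (ℕ → Fin k) → ℝ := fun i ω =>
    h (ω (i + 1)) (orbit f ω (i + 1) x) - transfer P f h (ω i) (orbit f ω i x) with hD
  have hdep : ∀ i n, i + 1 ≤ n → DependsOn (D i) (Set.Iic n) := by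
    intro i n hin ω ω' hω
    simp only [hD]
    rw [hω i (by simp; omega), hω (i + 1) hin,
      orbit_congr f (n := i) fun j hj => hω j (by simp; omega),
      orbit_congr f (n := i + 1) fun j hj => hω j (by simp; omega)]
  refine ae_tendsto_average_of_orthogonal (D := D) (C := C + C)
    (fun i => measurable_of_dependsOn (hdep i _ le_rfl)) (fun i ω => ?_) fun i j hij => ?_
  · exact (abs_sub _ _).trans (add_le_add (hC _ _) (abs_transfer_le f hP hC _ _))
  · have hM := integral_markovMeasure_succ hP h0 h1 (n := j) (H := fun ω d => D i ω *
      (h d (f (ω j) (orbit f ω j x)) - transfer P f h (ω j) (orbit f ω j x)))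
      (fun d ω ω' hω => by
        simp only
        rw [hdep i j hij hω, hω j (by simp),
          orbit_congr f (n := j) fun l hl => hω l (by simp; omega)])
    refine hM.trans ?_
    rw [← integral_zero (ℕ → Fin k) ℝ (μ := markovMeasure P p)]
    refine integral_congr_ae (Eventually.of_forall fun ω => ?_)
    simp only [mul_left_comm _ (D i ω)]
    rw [← Finset.mul_sum]
    simp only [mul_sub, Finset.sum_sub_distrib, ← Finset.sum_mul,
      Matrix.sum_row_of_mem_rowStochastic hP, one_mul]
    simp [transfer]

/-- Averages of `h` and of its image under an iterate of the Markov operator are asymptotically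
equal along almost every random orbit. -/
theorem ae_tendsto_average_sub_iterate_transfer (hP : P ∈ Matrix.rowStochastic ℝ (Fin k))
    (h0 : ∀ i, 0 ≤ p i) (h1 : ∑ i, p i = 1) {h : Fin k → X → ℝ} {C : ℝ}
    (hC : ∀ i y, |h i y| ≤ C) (x : X) (N : ℕ) :
    ∀ᵐ ω ∂(markovMeasure P p), Tendsto (fun n : ℕ => (∑ i ∈ Finset.range n,
      (h (ω i) (orbit f ω i x) - (transfer P f)^[N] h (ω i) (orbit f ω i x))) / (n : ℝ))
      atTop (𝓝 0) := by
  induction N generalizing h with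
  | zero => simp
  | succ N ih =>
    filter_upwards [ae_tendsto_average_increments f hP h0 h1 hC x,
      ih (h := transfer P f h) (abs_transfer_le f hP hC)] with ω hω₁ hω₂
    have hbd : Tendsto (fun n : ℕ =>
        (h (ω 0) (orbit f ω 0 x) - h (ω n) (orbit f ω n x)) / (n : ℝ)) atTop (𝓝 0) := by
      refine squeeze_zero_norm (a := fun n : ℕ => (C + C) / n) (fun n => ?_)
        (tendsto_const_div_atTop_nhds_zero_nat _)
      rw [norm_div, Real.norm_eq_abs, Real.norm_eq_abs, Nat.abs_cast]
      gcongr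
      exact (abs_sub _ _).trans (add_le_add (hC _ _) (hC _ _))
    have hsum := (hω₁.add hω₂).add hbd
    simp only [add_zero] at hsum
    refine hsum.congr fun n => ?_
    rw [← add_div, ← add_div, Function.iterate_succ_apply]
    congr 1
    have htel := Finset.sum_range_sub' (fun i => h (ω i) (orbit f ω i x)) n
    rw [← htel, ← Finset.sum_add_distrib, ← Finset.sum_add_distrib]
    exact Finset.sum_congr rfl fun i _ => by ring

/-- If some iterates of the Markov operator bring `h` uniformly close to a constant, then the
averages of `h` along almost every random orbit converge to this constant. -/
theorem ae_tendsto_average_of_iterate_transfer (hP : P ∈ Matrix.rowStochastic ℝ (Fin k))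
    (h0 : ∀ i, 0 ≤ p i) (h1 : ∑ i, p i = 1) {h : Fin k → X → ℝ} {C : ℝ}
    (hC : ∀ i y, |h i y| ≤ C) {c : ℝ}
    (hc : ∀ ε > 0, ∃ N : ℕ, ∀ i y, |(transfer P f)^[N] h i y - c| ≤ ε) (x : X) :
    ∀ᵐ ω ∂(markovMeasure P p), Tendsto (fun n : ℕ =>
      (1 / (n : ℝ)) * ∑ i ∈ Finset.range n, h (ω i) (orbit f ω i x)) atTop (𝓝 c) := by
  filter_upwards [ae_all_iff.2 fun N => ae_tendsto_average_sub_iterate_transfer f hP h0 h1 hC x N]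
    with ω hω
  refine Metric.tendsto_atTop'.2 fun ε hε => ?_
  obtain ⟨N, hN⟩ := hc (ε / 2) (half_pos hε)
  obtain ⟨n₀, hn₀⟩ := Metric.tendsto_atTop'.1 (hω N) (ε / 2) (half_pos hε)
  refine ⟨n₀, fun n hn => ?_⟩
  have hn0 : (0 : ℝ) < n := by exact_mod_cast (Nat.zero_le n₀).trans_lt hn
  have h2 := hn₀ n hn
  rw [Real.dist_eq, sub_zero] at h2
  rw [Real.dist_eq]
  have hdecomp : (1 / (n : ℝ)) * ∑ i ∈ Finset.range n, h (ω i) (orbit f ω i x) - c =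
      (∑ i ∈ Finset.range n,
        (h (ω i) (orbit f ω i x) - (transfer P f)^[N] h (ω i) (orbit f ω i x))) / (n : ℝ) +
      (∑ i ∈ Finset.range n, ((transfer P f)^[N] h (ω i) (orbit f ω i x) - c)) / (n : ℝ) := by
    simp only [Finset.sum_sub_distrib, Finset.sum_const, Finset.card_range, nsmul_eq_mul]
    field_simp
    ring
  have h3 : |(∑ i ∈ Finset.range n, ((transfer P f)^[N] h (ω i) (orbit f ω i x) - c)) / (n : ℝ)|
      ≤ ε / 2 := by
    rw [abs_div, abs_of_pos hn0, div_le_iff₀ hn0]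
    refine (Finset.abs_sum_le_sum_abs _ _).trans ?_
    refine (Finset.sum_le_sum fun i _ => hN _ _).trans (le_of_eq ?_)
    simp [mul_comm]
  rw [hdecomp]
  exact (abs_add_le _ _).trans_lt (by linarith)

/-- Reversal of time: the iterates of the Markov operator of the random product are expectations
for the inverse chain. -/
theorem integral_inverseMarkovMeasure_revOrbit (hP : P ∈ Matrix.rowStochastic ℝ (Fin k))
    (hp : IsStationaryVector P p) (hpos : ∀ i, 0 < p i) (φ : X → ℝ) (n : ℕ) (i : Fin k) (y : X) :
    ∫ ω, (if ω n = i then φ (revOrbit f ω (n + 1) y) else 0) ∂(inverseMarkovMeasure P p) =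
      p i * (transfer P f)^[n + 1] (fun _ z => φ z) i y := by
  have hQ := inverseMatrix_mem_rowStochastic hP hp hpos
  have := isProbabilityMeasure_markovMeasure hQ hp.1 hp.2.1
  rw [inverseMarkovMeasure]
  induction n generalizing i y with
  | zero =>
    have h := integral_markovMeasure_zero hQ hp.1 hp.2.1
      (fun j => if j = i then φ (f j y) else 0)
    refine h.trans ?_
    simp [transfer, ← Finset.sum_mul, Matrix.sum_row_of_mem_rowStochastic hP]
  | succ n ih =>
    have hdep : DependsOn (fun ω => revOrbit f ω (n + 1) (f i y)) (Set.Iic n) :=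
      fun ω ω' hω => by
        simp only [revOrbit_congr f (n := n + 1) fun j hj => hω j (by simp; omega)]
    have hM := integral_markovMeasure_succ hQ hp.1 hp.2.1 (n := n)
      (H := fun ω d => if d = i then φ (revOrbit f ω (n + 1) (f i y)) else 0)
      (fun d ω ω' hω => by
        have := hdep hω
        simp only at this
        simp only [this])
    have hl : ∀ ω : ℕ → Fin k,
        (if ω (n + 1) = i then φ (revOrbit f ω (n + 1 + 1) y) else 0) =
          if ω (n + 1) = i then φ (revOrbit f ω (n + 1) (f i y)) else 0 := by
      intro ω
      split_ifs with h
      · rw [revOrbit, h]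
        rfl
      · rfl
    simp_rw [hl]
    rw [hM, Function.iterate_succ_apply', transfer, Finset.mul_sum]
    have hr : ∀ ω : ℕ → Fin k, (∑ j, inverseMatrix P p (ω n) j *
        (if j = i then φ (revOrbit f ω (n + 1) (f i y)) else 0)) =
        ∑ j, inverseMatrix P p j i *
          (if ω n = j then φ (revOrbit f ω (n + 1) (f i y)) else 0) := by
      intro ω
      simp
    simp_rw [hr]
    rw [integral_finsetSum]
    · refine Finset.sum_congr rfl fun j _ => ?_
      rw [integral_const_mul, ih]
      simp only [inverseMatrix, Matrix.of_apply]
      field_simp [(hpos j).ne']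
    · intro j _
      refine (integrable_of_dependsOn (n := n) fun ω ω' hω => ?_).const_mul _
      have := hdep hω
      simp only at this
      simp only [this, hω n (by simp)]

end Transfer

/-! ### Convergence of the Markov operator -/

theorem exists_abs_le_of_continuous {X : Type*} [TopologicalSpace X] [CompactSpace X] {φ : X → ℝ}
    (hφ : Continuous φ) : ∃ C, ∀ x, |φ x| ≤ C := by
  obtain ⟨C, hC⟩ := (isCompact_range hφ).isBounded.exists_norm_le
  exact ⟨C, fun x => hC _ ⟨x, rfl⟩⟩

theorem dependsOn_revOrbit {k : ℕ} {X : Type*} (f : Fin k → X → X) (n : ℕ) (y : X) :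
    DependsOn (fun ω => revOrbit f ω (n + 1) y) (Set.Iic n) := fun ω ω' hω => by
  simp only [revOrbit_congr f (n := n + 1) fun j hj => hω j (by simp; omega)]

section Convergence

variable {k : ℕ} {X : Type*} [TopologicalSpace X] [CompactSpace X]
  {P : Matrix (Fin k) (Fin k) ℝ} {p : Fin k → ℝ} {f : Fin k → X → X}
  {π : (ℕ → Fin k) → X}

/-- The iterates of the Markov operator on a continuous function forget the point of `X`: after
reversal of time, the iterates in reverse order converge to a limit that does not depend on the
points they are applied to. Allowing arbitrary sequences of symbols and points makes this
uniform. -/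
theorem tendsto_iterate_transfer_sub (hP : P ∈ Matrix.rowStochastic ℝ (Fin k))
    (hp : IsStationaryVector P p) (hpos : ∀ i, 0 < p i)
    (hconv : ∀ᵐ ω ∂(inverseMarkovMeasure P p), ∀ y : ℕ → X,
      Tendsto (fun n => revOrbit f ω (n + 1) (y n)) atTop (𝓝 (π ω)))
    {φ : X → ℝ} (hφ : Continuous φ) (i : ℕ → Fin k) (y y' : ℕ → X) :
    Tendsto (fun n => (transfer P f)^[n + 1] (fun _ z => φ z) (i n) (y n) -
      (transfer P f)^[n + 1] (fun _ z => φ z) (i n) (y' n)) atTop (𝓝 0) := by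
  have : IsProbabilityMeasure (inverseMarkovMeasure P p) :=
    isProbabilityMeasure_markovMeasure (inverseMatrix_mem_rowStochastic hP hp hpos) hp.1 hp.2.1
  obtain ⟨C, hC⟩ := exists_abs_le_of_continuous hφ
  have hφm : ∀ n z, Measurable fun ω => φ (revOrbit f ω (n + 1) z) := fun n z =>
    measurable_of_dependsOn (n := n) fun ω ω' hω => congrArg φ (dependsOn_revOrbit f n z hω)
  set g : ℕ → (ℕ → Fin k) → ℝ := fun n ω =>
    φ (revOrbit f ω (n + 1) (y n)) - φ (revOrbit f ω (n + 1) (y' n)) with hg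
  have hgm : ∀ n, Measurable (g n) := fun n =>
    (hφm n _).sub (hφm n _)
  have hgC : ∀ n ω, ‖g n ω‖ ≤ C + C := fun n ω => (abs_sub _ _).trans (add_le_add (hC _) (hC _))
  have hlim : Tendsto (fun n => ∫ ω, |g n ω| ∂(inverseMarkovMeasure P p)) atTop (𝓝 0) := by
    have h := tendsto_integral_of_dominated_convergence (μ := inverseMarkovMeasure P p)
      (F := fun n ω => |g n ω|) (f := fun _ => 0) (fun _ => C + C)
      (fun n => ((hgm n).norm).aestronglyMeasurable) (integrable_const _)
      (fun n => Eventually.of_forall fun ω => by simpa using hgC n ω) ?_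
    · simpa using h
    · filter_upwards [hconv] with ω hω
      have h := (((hφ.tendsto _).comp (hω y)).sub ((hφ.tendsto _).comp (hω y'))).abs
      simpa using h
  have : Nonempty (Fin k) := ⟨i 0⟩
  obtain ⟨i₀, hi₀⟩ := Finite.exists_min p
  refine squeeze_zero_norm (a := fun n => (p i₀)⁻¹ * ∫ ω, |g n ω| ∂(inverseMarkovMeasure P p))
    (fun n => ?_) (by simpa using hlim.const_mul (p i₀)⁻¹)
  rw [← div_eq_inv_mul, le_div_iff₀ (hpos i₀)]
  have hint : ∀ z, Integrable (fun ω : ℕ → Fin k =>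
      if ω n = i n then φ (revOrbit f ω (n + 1) z) else 0) (inverseMarkovMeasure P p) := fun z =>
    integrable_of_dependsOn (n := n) fun ω ω' hω => by
      simp only [revOrbit_congr f (n := n + 1) fun j hj => hω j (by simp; omega), hω n (by simp)]
  calc ‖(transfer P f)^[n + 1] (fun _ z => φ z) (i n) (y n) -
          (transfer P f)^[n + 1] (fun _ z => φ z) (i n) (y' n)‖ * p i₀
      ≤ ‖(transfer P f)^[n + 1] (fun _ z => φ z) (i n) (y n) -
          (transfer P f)^[n + 1] (fun _ z => φ z) (i n) (y' n)‖ * p (i n) :=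
        mul_le_mul_of_nonneg_left (hi₀ _) (norm_nonneg _)
    _ = ‖∫ ω, ((if ω n = i n then φ (revOrbit f ω (n + 1) (y n)) else 0) -
          if ω n = i n then φ (revOrbit f ω (n + 1) (y' n)) else 0)
          ∂(inverseMarkovMeasure P p)‖ := by
        rw [integral_sub (hint _) (hint _),
          integral_inverseMarkovMeasure_revOrbit f hP hp hpos,
          integral_inverseMarkovMeasure_revOrbit f hP hp hpos, ← mul_sub, norm_mul,
          Real.norm_of_nonneg (hp.1 _), mul_comm]
    _ ≤ ∫ ω, |g n ω| ∂(inverseMarkovMeasure P p) := by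
        refine norm_integral_le_of_norm_le
          (Integrable.of_bound (hgm n).norm.aestronglyMeasurable (C + C)
            (Eventually.of_forall fun ω => by simpa using hgC n ω))
          (Eventually.of_forall fun ω => ?_)
        split_ifs
        · exact le_rfl
        · simp

/-- The iterates of the Markov operator on a continuous function `φ` converge uniformly to the
integral of `φ` with respect to the law of `π`: they forget the point of `X` by reversal of time,
and then the symbol by the convergence of the powers of `P`. -/
theorem exists_iterate_transfer_near_integral (hP : P ∈ Matrix.rowStochastic ℝ (Fin k))
    (hp : IsStationaryVector P p) (hprim : P.IsPrimitive)
    (hconv : ∀ᵐ ω ∂(inverseMarkovMeasure P p), ∀ y : ℕ → X,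
      Tendsto (fun n => revOrbit f ω (n + 1) (y n)) atTop (𝓝 (π ω)))
    {φ : X → ℝ} (hφ : Continuous φ) (x₀ : X) {ε : ℝ} (hε : 0 < ε) :
    ∃ N : ℕ, ∀ i y, |(transfer P f)^[N] (fun _ z => φ z) i y -
      ∫ ω, φ (π ω) ∂(inverseMarkovMeasure P p)| ≤ ε := by
  have hpos := hp.pos hprim
  have : IsProbabilityMeasure (inverseMarkovMeasure P p) :=
    isProbabilityMeasure_markovMeasure (inverseMatrix_mem_rowStochastic hP hp hpos) hp.1 hp.2.1
  obtain ⟨C, hC⟩ := exists_abs_le_of_continuous hφ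
  have hφm : ∀ n z, Measurable fun ω => φ (revOrbit f ω (n + 1) z) := fun n z =>
    measurable_of_dependsOn (n := n) fun ω ω' hω => congrArg φ (dependsOn_revOrbit f n z hω)
  have hε3 : 0 < ε / 3 := by positivity
  rcases isEmpty_or_nonempty (Fin k) with hk | hk
  · exact ⟨0, fun i => hk.elim i⟩
  have hx₀ : Nonempty X := ⟨x₀⟩
  set F : ℕ → Fin k × X × X → ℝ := fun n z => (transfer P f)^[n + 1] (fun _ z => φ z) z.1 z.2.1 -
    (transfer P f)^[n + 1] (fun _ z => φ z) z.1 z.2.2 with hF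
  have hosc : ∀ᶠ n in atTop, ∀ z, |F n z| ≤ ε / 3 := by
    -- A violating triple is chosen at each time where there is one.
    have hex : ∀ n, ∃ z, ε / 3 < |F n z| ∨ ∀ z', |F n z'| ≤ ε / 3 := by
      intro n
      by_cases h : ∀ z', |F n z'| ≤ ε / 3
      · exact ⟨Classical.arbitrary _, Or.inr h⟩
      · push Not at h
        obtain ⟨z, hz⟩ := h
        exact ⟨z, Or.inl hz⟩
    choose z hz using hex
    have hlim := (tendsto_iterate_transfer_sub hP hp hpos hconv hφ (fun n => (z n).1)
      (fun n => (z n).2.1) fun n => (z n).2.2).abs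
    rw [abs_zero] at hlim
    filter_upwards [hlim.eventually_lt_const hε3] with n hn
    exact (hz n).resolve_left hn.not_gt
  have hmean : Tendsto (fun n => ∑ i, p i * (transfer P f)^[n + 1] (fun _ z => φ z) i x₀) atTop
      (𝓝 (∫ ω, φ (π ω) ∂(inverseMarkovMeasure P p))) := by
    have h := tendsto_integral_of_dominated_convergence (μ := inverseMarkovMeasure P p)
      (F := fun n ω => φ (revOrbit f ω (n + 1) x₀)) (f := fun ω => φ (π ω)) (fun _ => C)
      (fun n => (hφm n _).aestronglyMeasurable) (integrable_const _)
      (fun n => Eventually.of_forall fun ω => hC _)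
      (hconv.mono fun ω hω => (hφ.tendsto _).comp (hω fun _ => x₀))
    refine h.congr fun n => ?_
    simp_rw [← integral_inverseMarkovMeasure_revOrbit f hP hp hpos]
    rw [← integral_finsetSum]
    · simp
    · intro i _
      exact integrable_of_dependsOn (n := n) fun ω ω' hω => by
        simp only [revOrbit_congr f (n := n + 1) fun j hj => hω j (by simp; omega),
          hω n (by simp)]
  obtain ⟨n, hn, hnm⟩ := (hosc.and (Metric.tendsto_nhds.1 hmean _ hε3)).exists
  set g : Fin k → ℝ := fun i => (transfer P f)^[n + 1] (fun _ z => φ z) i x₀ with hg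
  obtain ⟨m, hm⟩ := exists_pow_mulVec_near hP hp hprim g hε3
  refine ⟨m + (n + 1), fun i y => ?_⟩
  have hcontr := abs_iterate_transfer_sub_le f hP (h := (transfer P f)^[n + 1] fun _ z => φ z)
    (h' := fun i _ => g i) (fun i y => hn (i, y, x₀)) m i y
  rw [iterate_transfer_const_right] at hcontr
  rw [Function.iterate_add_apply]
  have hmi := hm i
  rw [Real.dist_eq] at hnm
  change |p ⬝ᵥ g - _| < _ at hnm
  rw [abs_le] at hcontr hmi ⊢
  rw [abs_lt] at hnm
  constructor <;> linarith [hcontr.1, hcontr.2, hmi.1, hmi.2, hnm.1, hnm.2]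

end Convergence

/-! ### Continuous observables and the coding map -/

/-- An invariant map takes its value at almost every sequence in the fibre of this sequence. -/
theorem ae_mem_fibre_of_isInvariantMap {k : ℕ} {X : Type*} [MeasurableSpace X]
    {f : Fin k → X → X} {ν : Measure (ℕ → Fin k)}
    (hν : MeasurePreserving shift ν ν) {ρ : (ℕ → Fin k) → X} (hρ : IsInvariantMap f ν ρ) :
    ∀ᵐ ω ∂ν, ρ ω ∈ fibre f ω := by
  have h : ∀ n, ∀ᵐ ω ∂ν, revOrbit f ω n (ρ (shift^[n] ω)) = ρ ω := by
    intro n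
    induction n with
    | zero => simp [revOrbit]
    | succ n ih =>
      filter_upwards [hν.quasiMeasurePreserving.ae ih, hρ.2] with ω h1 h2
      rw [revOrbit_succ_eq_comp_shift, Function.comp_apply, Function.iterate_succ_apply, h1, h2]
  filter_upwards [ae_all_iff.2 h] with ω hω
  exact Set.mem_iInter.2 fun n => ⟨_, hω (n + 1)⟩

section Main

variable {k : ℕ} {X : Type*} [MetricSpace X] [CompactSpace X] [MeasurableSpace X]
  [BorelSpace X] {P : Matrix (Fin k) (Fin k) ℝ} {p : Fin k → ℝ} {f : Fin k → X → X}
  {π : (ℕ → Fin k) → X}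

/-- If the averages of every function of a dense set of continuous functions along a sequence
converge to the integrals, then so do those of all continuous functions. -/
theorem tendsto_average_of_dense {ν : Measure X} [IsProbabilityMeasure ν] {S : Set C(X, ℝ)}
    (hS : Dense S) {u : ℕ → X}
    (h : ∀ ψ ∈ S, Tendsto (fun n : ℕ => (1 / (n : ℝ)) * ∑ i ∈ Finset.range n, ψ (u i)) atTop
      (𝓝 (∫ y, ψ y ∂ν))) (φ : C(X, ℝ)) :
    Tendsto (fun n : ℕ => (1 / (n : ℝ)) * ∑ i ∈ Finset.range n, φ (u i)) atTop
      (𝓝 (∫ y, φ y ∂ν)) := by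
  refine Metric.tendsto_atTop'.2 fun ε hε => ?_
  have hε3 : 0 < ε / 3 := by positivity
  obtain ⟨ψ, hψS, hψ⟩ := hS.exists_dist_lt φ hε3
  have hpt : ∀ x, |φ x - ψ x| ≤ ε / 3 := fun x => (ContinuousMap.dist_apply_le_dist x).trans hψ.le
  obtain ⟨n₀, hn₀⟩ := Metric.tendsto_atTop'.1 (h ψ hψS) _ hε3
  refine ⟨n₀, fun n hn => ?_⟩
  have hn0 : (0 : ℝ) < n := by exact_mod_cast (Nat.zero_le n₀).trans_lt hn
  have h1 := hn₀ n hn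
  have h2 : |(1 / (n : ℝ)) * ∑ i ∈ Finset.range n, φ (u i) -
      (1 / (n : ℝ)) * ∑ i ∈ Finset.range n, ψ (u i)| ≤ ε / 3 := by
    rw [← mul_sub, ← Finset.sum_sub_distrib, abs_mul, abs_of_pos (by positivity), one_div,
      inv_mul_le_iff₀ hn0]
    refine (Finset.abs_sum_le_sum_abs _ _).trans ?_
    refine (Finset.sum_le_sum fun i _ => hpt _).trans (le_of_eq ?_)
    simp
  have hint : ∀ χ : C(X, ℝ), Integrable χ ν := fun χ =>
    χ.continuous.integrable_of_hasCompactSupport (HasCompactSupport.of_compactSpace _)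
  have h3 : |∫ y, φ y ∂ν - ∫ y, ψ y ∂ν| ≤ ε / 3 := by
    rw [← integral_sub (hint φ) (hint ψ)]
    simpa using norm_integral_le_of_norm_le_const (μ := ν) (f := fun y => φ y - ψ y)
      (Eventually.of_forall hpt)
  rw [Real.dist_eq] at h1 ⊢
  rw [abs_lt] at h1 ⊢
  rw [abs_le] at h2 h3
  constructor <;> linarith [h1.1, h1.2, h2.1, h2.2, h3.1, h3.2]

/-- The exceptional null set does not depend on the observable, by separability of `C(X, ℝ)`. -/
theorem ae_forall_tendsto_average_orbit (hP : P ∈ Matrix.rowStochastic ℝ (Fin k))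
    (hp : IsStationaryVector P p) (hprim : P.IsPrimitive) (hπ : Measurable π)
    (hconv : ∀ᵐ ω ∂(inverseMarkovMeasure P p), ∀ y : ℕ → X,
      Tendsto (fun n => revOrbit f ω (n + 1) (y n)) atTop (𝓝 (π ω))) (x : X) :
    ∀ᵐ ω ∂(markovMeasure P p), ∀ φ : X → ℝ, Continuous φ →
      Tendsto (fun n : ℕ => (1 / (n : ℝ)) * ∑ i ∈ Finset.range n, φ (orbit f ω i x)) atTop
        (𝓝 (∫ y, φ y ∂((inverseMarkovMeasure P p).map π))) := by
  have : IsProbabilityMeasure (inverseMarkovMeasure P p) := isProbabilityMeasure_markovMeasure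
    (inverseMatrix_mem_rowStochastic hP hp (hp.pos hprim)) hp.1 hp.2.1
  have : IsProbabilityMeasure ((inverseMarkovMeasure P p).map π) :=
    Measure.isProbabilityMeasure_map hπ.aemeasurable
  obtain ⟨S, hSc, hSd⟩ := TopologicalSpace.exists_countable_dense C(X, ℝ)
  have hall : ∀ᵐ ω ∂(markovMeasure P p), ∀ ψ ∈ S,
      Tendsto (fun n : ℕ => (1 / (n : ℝ)) * ∑ i ∈ Finset.range n, ψ (orbit f ω i x)) atTop
        (𝓝 (∫ y, ψ y ∂((inverseMarkovMeasure P p).map π))) := by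
    rw [ae_ball_iff hSc]
    intro ψ _
    obtain ⟨C, hC⟩ := exists_abs_le_of_continuous ψ.continuous
    rw [integral_map hπ.aemeasurable ψ.continuous.aestronglyMeasurable]
    exact ae_tendsto_average_of_iterate_transfer f hP hp.1 hp.2.1 (h := fun _ z => ψ z)
      (fun _ => hC)
      (fun ε hε => exists_iterate_transfer_near_integral hP hp hprim hconv ψ.continuous x hε) x
  filter_upwards [hall] with ω hω φ hφ
  exact tendsto_average_of_dense hSd hω ⟨φ, hφ⟩

theorem measurable_limUnder_revOrbit (f : Fin k → X → X) (x₀ : X) :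
    Measurable fun ω =>
      haveI : Nonempty X := ⟨x₀⟩
      limUnder atTop fun n => revOrbit f ω (n + 1) x₀ := by
  have : Nonempty X := ⟨x₀⟩
  refine (StronglyMeasurable.limUnder fun n => ?_).measurable
  exact (measurable_of_dependsOn (dependsOn_revOrbit f n x₀)).stronglyMeasurable

/-- If almost every sequence is weakly hyperbolic, then the coding map is the unique invariant
map. -/
theorem exists_unique_isInvariantMap (hf : ∀ i, Continuous (f i)) (x₀ : X)
    {ν : Measure (ℕ → Fin k)} (hν : MeasurePreserving shift ν ν)
    (hS : ∀ᵐ ω ∂ν, ω ∈ weaklyHyperbolic f) :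
    ∃ π : (ℕ → Fin k) → X, IsInvariantMap f ν π ∧
      (∀ ρ : (ℕ → Fin k) → X, IsInvariantMap f ν ρ → ρ =ᵐ[ν] π) ∧
      ∀ ω ∈ weaklyHyperbolic f, ∀ y : ℕ → X,
        Tendsto (fun n => revOrbit f ω (n + 1) (y n)) atTop (𝓝 (π ω)) := by
  have : Nonempty X := ⟨x₀⟩
  set π : (ℕ → Fin k) → X := fun ω => limUnder atTop fun n => revOrbit f ω (n + 1) x₀ with hπ
  have hfib : ∀ ω ∈ weaklyHyperbolic f, fibre f ω = {π ω} := by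
    rintro ω ⟨z, hz⟩
    rw [hz, hπ]
    simp only
    rw [(tendsto_revOrbit hf hz fun _ => x₀).limUnder_eq]
  refine ⟨π, ⟨measurable_limUnder_revOrbit f x₀, ?_⟩, fun ρ hρ => ?_, fun ω hω y =>
    tendsto_revOrbit hf (hfib ω hω) y⟩
  · filter_upwards [hS, hν.quasiMeasurePreserving.ae hS] with ω h1 h2
    have hlim := ((hf (ω 0)).tendsto _).comp (tendsto_revOrbit hf (hfib _ h2) fun _ => x₀)
    have hlim' := (tendsto_revOrbit hf (hfib _ h1) fun _ => x₀).comp (tendsto_add_atTop_nat 1)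
    refine tendsto_nhds_unique hlim (hlim'.congr fun n => ?_)
    exact congrFun (revOrbit_succ_eq_comp_shift f ω (n + 1)) x₀
  · filter_upwards [hS, ae_mem_fibre_of_isInvariantMap hν hρ] with ω h1 h2
    rw [hfib ω h1] at h2
    exact h2

end Main

end RandomProduct

theorem corollary1 {Y : Type*} [MetricSpace Y] [TopologicalSpace.SeparableSpace Y]
    [MeasurableSpace Y] [BorelSpace Y]
    (hY : ∀ C : Set Y, IsConnected C → C.Nontrivial → (interior C).Nonempty)
    {m : ℕ} (hm : 1 ≤ m) (M : Set (Fin m → Y)) (hMcompact : IsCompact M) (hMconn : IsConnected M)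
    {k : ℕ} (P : Matrix (Fin k) (Fin k) ℝ) (p : Fin k → ℝ)
    (hP : P ∈ Matrix.rowStochastic ℝ (Fin k)) (hp : IsStationaryVector P p)
    (hprim : P.IsPrimitive)
    (f : Fin k → M → M) (hf : ∀ i, Continuous (f i)) (hsplit : Splits P f) :
    ∃ π : (ℕ → Fin k) → M,
      IsInvariantMap f (inverseMarkovMeasure P p) π ∧
      (∀ ρ : (ℕ → Fin k) → M, IsInvariantMap f (inverseMarkovMeasure P p) ρ →
        ρ =ᵐ[inverseMarkovMeasure P p] π) ∧
      (∀ᵐ ω ∂(inverseMarkovMeasure P p), ω ∈ weaklyHyperbolic f) ∧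
      (∀ ω ∈ weaklyHyperbolic f, ∀ x : M,
        Tendsto (fun n : ℕ => revOrbit f ω (n + 1) x) atTop (𝓝 (π ω))) ∧
      ∀ x : M, ∀ᵐ ω ∂(markovMeasure P p), ∀ φ : M → ℝ, Continuous φ →
        Tendsto (fun n : ℕ => (1 / (n : ℝ)) * ∑ i ∈ Finset.range n, φ (orbit f ω i x)) atTop
          (𝓝 (∫ y, φ y ∂((inverseMarkovMeasure P p).map π))) := by
  have hpos := hp.pos hprim
  have hQ := inverseMatrix_mem_rowStochastic hP hp hpos
  have : SecondCountableTopology Y := UniformSpace.secondCountable_of_separable Y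
  have : CompactSpace M := isCompact_iff_compactSpace.1 hMcompact
  have : ConnectedSpace M := isConnected_iff_connectedSpace.1 hMconn
  have hS : ∀ᵐ ω ∂(inverseMarkovMeasure P p), ω ∈ weaklyHyperbolic f := by
    obtain ⟨D, hDc, hDd⟩ := TopologicalSpace.exists_countable_dense Y
    obtain ⟨a, b, ha, hb, hadm, hbdm, hlast, hdisj⟩ := hsplit
    obtain ⟨N, -, hN⟩ := hprim.exists_pos_pow
    rw [← List.dropLast_append_getLast ha] at hadm hdisj
    rw [← List.dropLast_append_getLast hb, ← hlast] at hbdm hdisj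
    have hnull : ∀ (s : Fin m), ∀ y ∈ D, ∀ᵐ ω ∂(inverseMarkovMeasure P p),
        y ∉ ⋂ n, (fun z : M => (z : Fin m → Y) s) '' Set.range (revOrbit f ω n) := by
      intro s y _
      have h := markovMeasure_setOf_mem_iInter_eq_zero (P := P) hQ hp.1 hp.2.1
        (fun i j hij => mul_pos (div_pos (hpos i) (hpos j)) hij) (N := N)
        (fun i j => by
          rw [inverseMatrix_pow_apply hpos]
          exact mul_pos (div_pos (hpos j) (hpos i)) (hN j i))
        f (fun z : M => (z : Fin m → Y) s) hadm hbdm (fun ω n => by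
          obtain ⟨ω', hω'⟩ := exists_revOrbit_eq_orbit f ω n
          rw [hω']
          exact hdisj ω' n s) y
      rw [ae_iff]
      simp only [not_not]
      exact h
    have hnull' := ae_all_iff.2 fun s => (ae_ball_iff hDc).2 (hnull s)
    filter_upwards [hnull'] with ω hω
    exact mem_weaklyHyperbolic_of_forall_notMem hY hDd
      (fun s => (continuous_apply s).comp continuous_subtype_val)
      (fun x x' h => Subtype.ext (funext h)) hf hω
  obtain ⟨x₀⟩ : Nonempty M := inferInstance
  obtain ⟨π, hπ, huniq, hlim⟩ := exists_unique_isInvariantMap hf x₀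
    (measurePreserving_shift hQ (hp.inverseMatrix hP hpos)) hS
  exact ⟨π, hπ, huniq, hS, fun ω hω x => hlim ω hω fun _ => x,
    ae_forall_tendsto_average_orbit hP hp hprim hπ.1 (hS.mono hlim)⟩
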